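/- All graphs are finite and simple. A set $D$ of vertices of a graph $G$ is dominating if every vertex outside $D$ has a neighbour in $D$; the domination number $\gamma(G)$ is the minimum size of a dominating set. Contracting an edge $uv$ of $G$ removes $u$ and $v$ and replaces them by one new vertex that is adjacent to precisely those remaining vertices that were adjacent to $u$ or $v$ in $G$. The problem 1-Edge Contraction($\gamma$) takes a connected graph $G$ as its input and asks whether $G$ has an edge $e$ such that contracting $e$ reduces the domination number by at least one. Let $P_3+kP_2$ be the disjoint union of a path on three vertices and $k$ copies of a path on two vertices, and call a graph $H$-free if it has no induced subgraph isomorphic to $H$. Theorem. For every fixed integer $k \ge 0$, 1-Edge Contraction($\gamma$) can be solved in polynomial time on connected $(P_3+kP_2)$-free graphs; that is, there are a Turing machine and a polynomial $p$ (both may depend on $k$) such that on every connected $(P_3+kP_2)$-free graph $G$, given by the number of vertices in unary and the adjacency matrix, the machine halts after at most $p(\ell)$ steps, where $\ell$ is the length of the input, and answers correctly whether $G$ is a yes-instance. -/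

import Mathlib

namespace EdgeContraction

variable {V : Type*}

/-- `D` is a dominating set of `G`: every vertex outside `D` has a neighbour in `D`. -/
def IsDominatingSet (G : SimpleGraph V) (D : Finset V) : Prop :=
  ∀ v, v ∉ D → ∃ u ∈ D, G.Adj v u

/-- The domination number: the least cardinality of a dominating set. (On a finite graph the set of
all vertices is dominating, so the infimum is attained.) -/
noncomputable def dominationNumber (G : SimpleGraph V) : ℕ :=
  sInf {m | ∃ D : Finset V, IsDominatingSet G D ∧ D.card = m}

/-- Adjacency after the contraction of `uv`. The vertices are the old vertices other than `u` and
`v`, together with one new vertex `none`, which is adjacent to the old vertices that were adjacent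
to `u` or to `v`. -/
def contractAdj (G : SimpleGraph V) (u v : V) :
    Option {w : V // w ≠ u ∧ w ≠ v} → Option {w : V // w ≠ u ∧ w ≠ v} → Prop
  | none, none => False
  | none, some b => G.Adj u b ∨ G.Adj v b
  | some a, none => G.Adj u a ∨ G.Adj v a
  | some a, some b => G.Adj a b

/-- The graph obtained from `G` by contracting `uv`. -/
def contract (G : SimpleGraph V) (u v : V) : SimpleGraph (Option {w : V // w ≠ u ∧ w ≠ v}) where
  Adj := contractAdj G u v
  symm := ⟨by
    rintro (_ | a) (_ | b) h
    · exact h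
    · exact h
    · exact h
    · exact G.adj_symm h⟩
  loopless := ⟨by
    rintro (_ | a) h
    · exact h
    · exact G.loopless.irrefl _ h⟩

/-- Some edge of `G` can be contracted so that the domination number drops by at least one. -/
def IsYesInstance (G : SimpleGraph V) : Prop :=
  ∃ u v, G.Adj u v ∧ dominationNumber (contract G u v) + 1 ≤ dominationNumber G

/-- The disjoint union of `k` copies of `H`. -/
def copies (k : ℕ) (H : SimpleGraph V) : SimpleGraph (Fin k × V) where
  Adj x y := x.1 = y.1 ∧ H.Adj x.2 y.2
  symm := ⟨fun _ _ h => ⟨h.1.symm, h.2.symm⟩⟩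
  loopless := ⟨fun _ h => H.loopless.irrefl _ h.2⟩

/-- The graph `P₃ + k P₂`. -/
def P3kP2 (k : ℕ) : SimpleGraph (Fin 3 ⊕ (Fin k × Fin 2)) :=
  SimpleGraph.sum (SimpleGraph.pathGraph 3) (copies k (SimpleGraph.pathGraph 2))

/-- `G` is `H`-free: no induced subgraph of `G` is isomorphic to `H`. -/
def InducedFree {W : Type*} (H : SimpleGraph W) (G : SimpleGraph V) : Prop :=
  ¬ H.IsIndContained G

/-- The input graphs: finite simple graphs on `{0, …, n - 1}`. Every finite graph is isomorphic to
one of these. -/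
abbrev FinGraph : Type := Σ n : ℕ, SimpleGraph (Fin n)

open Classical in
/-- A graph on `n` vertices as a binary string: `n` in unary, then the rows of the
adjacency matrix. -/
noncomputable def encodeGraph (G : FinGraph) : List Bool :=
  List.replicate G.1 true ++ false ::
    (List.finRange G.1).flatMap fun i => (List.finRange G.1).map fun j => decide (G.2.Adj i j)

open Classical in
/-- The question "`G ∈ Y`?" can be answered in polynomial time for the input graphs `G ∈ 𝒞`: there
are one multi-stack Turing machine and one polynomial `p` such that the machine, started on the
encoding (of length `ℓ`) of any `G ∈ 𝒞`, halts within `p(ℓ)` steps and outputs the right bit. -/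
def PolyTimeDecidableOn (𝒞 Y : Set FinGraph) : Prop :=
  Nonempty (Turing.TM2ComputableInPolyTime (fun G : 𝒞 => encodeGraph G.1)
    Computability.encodeBool (fun G : 𝒞 => decide (G.1 ∈ Y)))

end EdgeContraction

/-! Contracting an edge can lower the domination number exactly when some minimum dominating set
contains an edge (`isYesInstance_iff`). If the domination number is bounded in terms of `k`, this is
a statement about boundedly many vertices. For larger domination numbers, no-instances have a
certificate of bounded size.

Take an induced matching of bounded but large size and let `U` consist of the vertices with
neighbours in two of its edges. Freeness makes `G - U` a disjoint union of cliques, the clusters,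
and each vertex of `U` misses two or more vertices of at most `k + 1` clusters
(`IsInducedMatching.isClusterCut`). The matching is a certificate if no `s` vertices of `U`, with `1
≤ s ≤ 3k + 5`, dominate `s` clusters. Soundness (`HasCertificate.not_isYesInstance`): the domination
number is then at most the number of clusters, and a dominating set of at most that size takes one
vertex from each cluster, hence has no edge. Completeness (`hasCertificate_of_lt_card`): in a
no-instance with a large minimum dominating set `D`, a suitable large matching exists and `D` avoids
its `U`. If `s` vertices of `U` dominated `s` clusters, they could replace the vertices of `D` in
these clusters. The choice of representatives in the remaining clusters is so free that some choice
completes them to a dominating set containing an edge (`IsClusterCut.exists_dominating_hasEdge`);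
otherwise the failing choices would produce an induced `P₃ + kP₂`.

Thus on the given class the yes-instances are defined by one first-order sentence. A first-order
sentence is decided in polynomial time by running through all tuples of some fixed length and
collecting their types: an odometer made of marks on the input is advanced by one sweep of a finite
transducer per tuple. -/

namespace EdgeContraction

open Finset

/-! ### Edge contraction and edges in minimum dominating sets -/

/-- `D` contains two adjacent vertices. -/
def HasEdge {V : Type*} (G : SimpleGraph V) (D : Finset V) : Prop :=
  ∃ u ∈ D, ∃ v ∈ D, G.Adj u v

theorem dominationNumber_le {V : Type*} {G : SimpleGraph V} {D : Finset V}
    (h : IsDominatingSet G D) : dominationNumber G ≤ D.card :=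
  Nat.sInf_le ⟨D, h, rfl⟩

theorem exists_card_eq_dominationNumber {V : Type*} [Finite V] (G : SimpleGraph V) :
    ∃ D, IsDominatingSet G D ∧ D.card = dominationNumber G := by
  have := Fintype.ofFinite V
  exact Nat.sInf_mem (s := {m | ∃ D : Finset V, IsDominatingSet G D ∧ D.card = m})
    ⟨_, univ, fun v hv => absurd (mem_univ v) hv, rfl⟩

open Classical in
/-- Contracting an edge can lower the domination number iff some minimum dominating set contains
an edge. -/
theorem isYesInstance_iff {V : Type*} [Finite V] (G : SimpleGraph V) :
    IsYesInstance G ↔ ∃ D, IsDominatingSet G D ∧ HasEdge G D ∧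
      ∀ D', IsDominatingSet G D' → D.card ≤ D'.card := by
  have := Fintype.ofFinite V
  constructor
  · rintro ⟨u, v, huv, h⟩
    obtain ⟨D', hD', hc⟩ := exists_card_eq_dominationNumber (contract G u v)
    have old : ∀ a : {w : V // w ≠ u ∧ w ≠ v}, a.1 ≠ u ∧ a.1 ≠ v := fun a => a.2
    set D₀ : Finset V := (eraseNone D').map (Function.Embedding.subtype _) with hD₀
    have mem₀ : ∀ a : {w : V // w ≠ u ∧ w ≠ v}, some a ∈ D' → a.1 ∈ D₀ := by
      intro a ha
      simp only [hD₀, mem_map, mem_eraseNone, Function.Embedding.subtype_apply]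
      exact ⟨a, ha, rfl⟩
    have card₀ : D₀.card = (eraseNone D').card := card_map _
    suffices ∃ D, IsDominatingSet G D ∧ HasEdge G D ∧ D.card ≤ D'.card + 1 by
      obtain ⟨D, h1, h2, h3⟩ := this
      exact ⟨D, h1, h2, fun E hE => by have := dominationNumber_le hE; omega⟩
    -- If the new vertex is in `D'`, both `u` and `v` replace it. Otherwise some `x ∈ D'` is
    -- adjacent to an end of `uv`; adding that end creates an edge and dominates the other end.
    -- Either way the size grows by at most one.
    by_cases hn : none ∈ D'
    · refine ⟨insert u (insert v D₀), ?_, ⟨u, by simp, v, by simp, huv⟩, ?_⟩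
      · intro w hw
        simp only [mem_insert, not_or] at hw
        have hw' : some (⟨w, hw.1, hw.2.1⟩ : {w : V // w ≠ u ∧ w ≠ v}) ∉ D' :=
          fun h => hw.2.2 (mem₀ _ h)
        obtain ⟨x, hx, hadj⟩ := hD' _ hw'
        rcases x with _ | x
        · rcases hadj with hadj | hadj
          · exact ⟨u, by simp, hadj.symm⟩
          · exact ⟨v, by simp, hadj.symm⟩
        · exact ⟨x.1, by simp [mem₀ x hx], hadj⟩
      · have h1 := card_insert_le u (insert v D₀)
        have h2 := card_insert_le v D₀
        have h3 : (eraseNone D').card + 1 = D'.card := by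
          rw [card_eraseNone_of_mem hn]
          have := card_pos.2 ⟨_, hn⟩
          omega
        omega
    · have h3 : (eraseNone D').card = D'.card := card_eraseNone_of_not_mem hn
      obtain ⟨x, hx, hadj⟩ := hD' none hn
      rcases x with _ | x
      · exact absurd hx hn
      have dom : ∀ w, w ≠ u → w ≠ v → w ∉ D₀ → ∃ y ∈ D₀, G.Adj w y := by
        intro w h1 h2 hw
        obtain ⟨x, hx, hadj⟩ := hD' (some ⟨w, h1, h2⟩) fun h => hw (mem₀ _ h)
        rcases x with _ | x
        · exact absurd hx hn
        · exact ⟨x.1, mem₀ x hx, hadj⟩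
      have key : ∀ u' v', G.Adj u' v' → G.Adj u' x → (∀ w, w ≠ u' → w ≠ v' → w ∉ D₀ →
          ∃ y ∈ D₀, G.Adj w y) → ∃ D, IsDominatingSet G D ∧ HasEdge G D ∧ D.card ≤ D'.card + 1 := by
        intro u' v' huv' hx' dom'
        refine ⟨insert u' D₀, ?_, ⟨u', by simp, x, by simp [mem₀ x hx], hx'⟩, ?_⟩
        · intro w hw
          simp only [mem_insert, not_or] at hw
          by_cases hwv : w = v'
          · exact ⟨u', by simp, hwv ▸ huv'.symm⟩
          · obtain ⟨y, hy, h⟩ := dom' w hw.1 hwv hw.2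
            exact ⟨y, by simp [hy], h⟩
        · have h1 := card_insert_le u' D₀
          omega
      rcases hadj with hadj | hadj
      · exact key u v huv hadj dom
      · exact key v u huv.symm hadj fun w h1 h2 => dom w h2 h1
  · rintro ⟨D, hD, ⟨u, hu, v, hv, huv⟩, hmin⟩
    refine ⟨u, v, huv, ?_⟩
    obtain ⟨E, hE, hEc⟩ := exists_card_eq_dominationNumber G
    have hDE := hmin E hE
    set D₁ : Finset {w : V // w ≠ u ∧ w ≠ v} := D.subtype _ with hD₁
    have hcard : D₁.card + 2 ≤ D.card := by
      have h1 : D₁.card = ((D.erase u).erase v).card := by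
        rw [hD₁, card_subtype]
        congr 1
        ext w
        simp only [mem_filter, mem_erase]
        tauto
      have h2 := card_erase_of_mem (mem_erase.2 ⟨huv.ne', hv⟩ : v ∈ D.erase u)
      have h3 := card_erase_of_mem hu
      have h4 : 0 < (D.erase u).card := card_pos.2 ⟨v, mem_erase.2 ⟨huv.ne', hv⟩⟩
      omega
    have hdom : IsDominatingSet (contract G u v) (insertNone D₁) := by
      intro x hx
      rcases x with _ | x
      · simp at hx
      · have hxD : x.1 ∉ D := by simpa [hD₁] using hx
        obtain ⟨y, hy, hxy⟩ := hD _ hxD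
        by_cases hyu : y = u
        · exact ⟨none, by simp, Or.inl (hyu ▸ hxy.symm)⟩
        by_cases hyv : y = v
        · exact ⟨none, by simp, Or.inr (hyv ▸ hxy.symm)⟩
        exact ⟨some ⟨y, hyu, hyv⟩, by simpa [hD₁] using hy, hxy⟩
    have := dominationNumber_le hdom
    rw [card_insertNone] at this
    omega

/-! ### Bounding a minimum dominating set without large matchings to its complement -/

/-- The pairs in `M` are the edges of an induced matching of `G` that goes from `D \ E` to vertices
outside `D` which have no neighbour in `E`. -/
structure IsMatchingFrom {V : Type*} (G : SimpleGraph V) (D E : Finset V) (M : Finset (V × V)) :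
    Prop where
  fst_mem : ∀ p ∈ M, p.1 ∈ D
  fst_notMem : ∀ p ∈ M, p.1 ∉ E
  snd_notMem : ∀ p ∈ M, p.2 ∉ D
  adj : ∀ p ∈ M, G.Adj p.1 p.2
  not_adj : ∀ p ∈ M, ∀ e ∈ E, ¬ G.Adj e p.2
  fst_snd : ∀ p ∈ M, ∀ q ∈ M, p ≠ q → ¬ G.Adj p.1 q.2
  snd_snd : ∀ p ∈ M, ∀ q ∈ M, p ≠ q → ¬ G.Adj p.2 q.2

section Matching

variable {V : Type*} {G : SimpleGraph V} {D E : Finset V} {M : Finset (V × V)}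

theorem IsMatchingFrom.empty : IsMatchingFrom G D E ∅ := by
  constructor <;> simp

theorem IsMatchingFrom.mono {E' : Finset V} (h : IsMatchingFrom G D E' M) (hE : E ⊆ E') :
    IsMatchingFrom G D E M :=
  ⟨h.fst_mem, fun p hp hE' => h.fst_notMem p hp (hE hE'), h.snd_notMem, h.adj,
    fun p hp e he => h.not_adj p hp e (hE he), h.fst_snd, h.snd_snd⟩

theorem IsMatchingFrom.fst_injOn (h : IsMatchingFrom G D E M) : Set.InjOn Prod.fst (M : Set (V × V)) := by
  intro p hp q hq hpq
  by_contra hne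
  exact h.fst_snd p hp q hq hne (hpq ▸ h.adj q hq)

open Classical in
theorem IsMatchingFrom.card_fst (h : IsMatchingFrom G D E M) : (M.image Prod.fst).card = M.card :=
  card_image_of_injOn h.fst_injOn

open Classical in
theorem IsMatchingFrom.insert (h : IsMatchingFrom G D E M) {d y : V} (hd : d ∈ D) (hdE : d ∉ E)
    (hy : y ∉ D) (hdy : G.Adj d y) (hyE : ∀ e ∈ E, ¬ G.Adj e y)
    (h1 : ∀ p ∈ M, ¬ G.Adj p.1 y) (h2 : ∀ p ∈ M, ¬ G.Adj p.2 y) (h3 : ∀ p ∈ M, ¬ G.Adj d p.2) :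
    IsMatchingFrom G D E (insert (d, y) M) := by
  constructor
  · simp only [mem_insert, forall_eq_or_imp]; exact ⟨hd, h.fst_mem⟩
  · simp only [mem_insert, forall_eq_or_imp]; exact ⟨hdE, h.fst_notMem⟩
  · simp only [mem_insert, forall_eq_or_imp]; exact ⟨hy, h.snd_notMem⟩
  · simp only [mem_insert, forall_eq_or_imp]; exact ⟨hdy, h.adj⟩
  · simp only [mem_insert, forall_eq_or_imp]; exact ⟨hyE, h.not_adj⟩
  · intro p hp q hq hne
    rw [mem_insert] at hp hq
    rcases hp with rfl | hp <;> rcases hq with rfl | hq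
    · exact absurd rfl hne
    · exact h3 q hq
    · exact h1 p hp
    · exact h.fst_snd p hp q hq hne
  · intro p hp q hq hne
    rw [mem_insert] at hp hq
    rcases hp with rfl | hp <;> rcases hq with rfl | hq
    · exact absurd rfl hne
    · exact fun h => h2 q hq h.symm
    · exact h2 p hp
    · exact h.snd_snd p hp q hq hne

/-- A vertex that is dominated neither by `E` nor by the far ends of a maximum matching has a
neighbour among the near ends. -/
theorem exists_adj_of_maximum {E : Finset V} {M : Finset (V × V)} (hM : IsMatchingFrom G D E M)
    (hmax : ∀ M', IsMatchingFrom G D E M' → M'.card ≤ M.card) {d y : V} (hd : d ∈ D) (hy : y ∉ D)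
    (hdy : G.Adj d y) (hyE : ∀ e ∈ E, ¬ G.Adj e y) (h2 : ∀ p ∈ M, ¬ G.Adj p.2 y)
    (h3 : ∀ p ∈ M, p.1 ≠ d → ¬ G.Adj d p.2) : ∃ p ∈ M, G.Adj p.1 y := by
  classical
  by_contra! h1
  have h := hM.insert hd (fun h => hyE d h hdy) hy hdy hyE h1 h2 fun p hp =>
    h3 p hp fun h => h1 p hp (h ▸ hdy)
  have hlt := hmax _ h
  rw [card_insert_of_notMem fun hmem => h1 _ hmem hdy] at hlt
  omega

end Matching

section Bounded

variable {V : Type*} [Fintype V] (G : SimpleGraph V) (D : Finset V)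

open Classical in
theorem exists_maximum_matchingFrom (E : Finset V) :
    ∃ M, IsMatchingFrom G D E M ∧ ∀ M', IsMatchingFrom G D E M' → M'.card ≤ M.card := by
  obtain ⟨M, hM, h⟩ := exists_max_image (univ.filter (IsMatchingFrom G D E)) Finset.card
    ⟨∅, by simp [IsMatchingFrom.empty]⟩
  exact ⟨M, by simpa using hM, fun M' hM' => h M' (by simpa using hM')⟩

variable {G D}

/-- Minimise `(K + 1) * |M E| + |E|`, where `M E` is a maximum matching for `E`. Enlarging a
minimiser by at most `K` vertices cannot lower `|M E|`, since that would gain `K + 1` and cost at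
most `K`. Comparison with `E₀` bounds the minimiser. -/
theorem exists_stable {K : ℕ} (hK : ∀ M, IsMatchingFrom G D ∅ M → M.card < K) {E₀ : Finset V}
    (hE₀ : E₀ ⊆ D) :
    ∃ E s, E₀ ⊆ E ∧ E ⊆ D ∧ E.card ≤ E₀.card + (K + 1) * K ∧ s ≤ K ∧
      (∀ M, IsMatchingFrom G D E M → M.card ≤ s) ∧
      ∀ E', E ⊆ E' → E' ⊆ D → E'.card ≤ E.card + K →
        ∃ M, IsMatchingFrom G D E' M ∧ M.card = s := by
  classical
  choose M hM hmax using exists_maximum_matchingFrom G D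
  obtain ⟨E, hE, hmin⟩ := exists_min_image (D.powerset.filter (E₀ ⊆ ·))
    (fun E => (K + 1) * (M E).card + E.card) ⟨E₀, by simpa using hE₀⟩
  have hlt : ∀ E, (M E).card < K := fun E => hK _ ((hM E).mono (empty_subset _))
  simp only [mem_filter, mem_powerset] at hE hmin
  refine ⟨E, (M E).card, hE.2, hE.1, ?_, (hlt E).le, hmax E, fun E' hEE' hE'D hc =>
    ⟨M E', hM E', ?_⟩⟩
  · have h1 := hmin E₀ ⟨hE₀, Subset.rfl⟩
    have h2 : (K + 1) * (M E₀).card ≤ (K + 1) * K := Nat.mul_le_mul_left _ (hlt _).le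
    omega
  · have h1 := hmin E' ⟨hE'D, hE.2.trans hEE'⟩
    have h2 := hmax E _ ((hM E').mono hEE')
    refine le_antisymm h2 (not_lt.1 fun hl => ?_)
    have h3 : (K + 1) * ((M E').card + 1) ≤ (K + 1) * (M E).card :=
      Nat.mul_le_mul_left _ hl
    rw [Nat.mul_add] at h3
    omega

/-- If the complement of a minimum dominating set `D` is dominated by few vertices, then all but
few vertices of `D` have pairwise disjoint neighbourhoods. -/
theorem exists_disjoint_neighbors (hmin : ∀ D', IsDominatingSet G D' → D.card ≤ D'.card)
    {F₀ : Finset V} (hF₀ : ∀ y, y ∉ D → y ∉ F₀ → ∃ f ∈ F₀, G.Adj y f) :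
    ∃ E, E ⊆ D ∧ E.card ≤ 2 * F₀.card ∧
      ∀ d ∈ D, d ∉ E → ∀ d' ∈ D, d' ∉ E → d ≠ d' → ∀ w, G.Adj d w → ¬ G.Adj d' w := by
  classical
  -- `W` dominates `E` at half the price. Trading `E` for `F₀ ∪ W` keeps domination, so `|E| ≤ |F₀|
  -- + |W|` by minimality, hence `|E| ≤ 2|F₀|`. Two vertices outside a largest such `E` with a
  -- common neighbour could be added to it.
  let P : Finset V → Finset V → Prop := fun E W =>
    E ⊆ D ∧ 2 * W.card ≤ E.card ∧ ∀ e ∈ E, ∃ w ∈ W, G.Adj e w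
  obtain ⟨⟨E, W⟩, hEW, hmax⟩ := exists_max_image
    (univ.filter fun p : Finset V × Finset V => P p.1 p.2) (fun p => p.1.card)
    ⟨(∅, ∅), by simp [P]⟩
  simp only [mem_filter, mem_univ, true_and, Prod.forall, P] at hEW hmax
  obtain ⟨hED, hWc, hdom⟩ := hEW
  have hdomF : IsDominatingSet G (F₀ ∪ (W ∪ (D \ E))) := by
    intro v hv
    simp only [mem_union, mem_sdiff, not_or, not_and, not_not] at hv
    by_cases hvD : v ∈ D
    · obtain ⟨w, hw, h⟩ := hdom v (hv.2.2 hvD)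
      exact ⟨w, by simp [hw], h⟩
    · obtain ⟨w, hw, h⟩ := hF₀ v hvD hv.1
      exact ⟨w, by simp [hw], h⟩
  have h1 := hmin _ hdomF
  have h2 := card_union_le F₀ (W ∪ (D \ E))
  have h3 := card_union_le W (D \ E)
  have h4 := card_sdiff_add_card_eq_card hED
  by_cases hc : E.card ≤ 2 * F₀.card
  · refine ⟨E, hED, hc, fun d hd hdE d' hd' hdE' hne w hw hw' => ?_⟩
    have hcard : (insert d (insert d' E)).card = E.card + 2 := by
      rw [card_insert_of_notMem (show d ∉ insert d' E by simp [hne, hdE]),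
        card_insert_of_notMem hdE']
    have h5 := hmax (insert d (insert d' E)) (insert w W) ⟨?_, ?_, ?_⟩
    · omega
    · simp [insert_subset_iff, hd, hd', hED]
    · have := card_insert_le w W
      omega
    · intro e he
      simp only [mem_insert] at he
      rcases he with rfl | rfl | he
      · exact ⟨w, by simp, hw⟩
      · exact ⟨w, by simp, hw'⟩
      · obtain ⟨x, hx, h⟩ := hdom e he
        exact ⟨x, by simp [hx], h⟩
  · omega

/-- Let `D` be a minimum dominating set such that no dominating set of that size contains an edge.
If the complement of `D` is dominated by few vertices and there is no large induced matching
between `D` and its complement, then `D` is small. -/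
theorem card_le_of_matching_lt (hdeg : ∀ v, ∃ w, G.Adj v w)
    (hD : IsDominatingSet G D) (hmin : ∀ D', IsDominatingSet G D' → D.card ≤ D'.card)
    (hind : ∀ D', IsDominatingSet G D' → D'.card ≤ D.card → ¬ HasEdge G D') {K : ℕ}
    (hK : ∀ M, IsMatchingFrom G D ∅ M → M.card < K)
    {F₀ : Finset V} (hF₀ : ∀ y, y ∉ D → y ∉ F₀ → ∃ f ∈ F₀, G.Adj y f) :
    D.card ≤ 2 * F₀.card + (K + 1) * K + K := by
  classical
  obtain ⟨E₀, hE₀, hE₀c, hE₀d⟩ := exists_disjoint_neighbors hmin hF₀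
  obtain ⟨E, s, hEE, hED, hEc, hsK, hsmax, hst⟩ := exists_stable hK hE₀
  have hdisj : ∀ d ∈ D, d ∉ E → ∀ d' ∈ D, d' ∉ E → d ≠ d' → ∀ w, G.Adj d w → ¬ G.Adj d' w :=
    fun d hd hdE d' hd' hdE' => hE₀d d hd (fun h => hdE (hEE h)) d' hd' fun h => hdE' (hEE h)
  obtain ⟨M₁, hM₁, hc₁⟩ := hst E Subset.rfl hED (by omega)
  -- By stability a matching that avoids the near ends of `M₁` is still as large, so `M₁` and `M₂`
  -- are both maximum for `E` and have disjoint sets of near ends.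
  obtain ⟨M₂, hM₂, hc₂⟩ := hst (E ∪ M₁.image Prod.fst) subset_union_left
    (union_subset hED fun x hx => by
      obtain ⟨p, hp, rfl⟩ := mem_image.1 hx
      exact hM₁.fst_mem p hp)
    (by
      have h1 := card_union_le E (M₁.image Prod.fst)
      have h2 := hM₁.card_fst
      omega)
  have hM₂' := hM₂.mono (E := E) subset_union_left
  have hnot : ∀ d, d ∈ D → ∀ w, G.Adj d w → w ∉ D := fun d hd w hw hwD =>
    hind D hD le_rfl ⟨d, hd, w, hwD, hw⟩
  -- the neighbour by which a vertex of `D` is replaced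
  have hf : ∃ f : V → V, (∀ d ∈ D, d ∉ E → G.Adj d (f d)) ∧ (∀ p ∈ M₁, f p.1 = p.2) ∧
      ∀ p ∈ M₂, f p.1 = p.2 := by
    choose g hg using hdeg
    have hpick : ∀ M, IsMatchingFrom G D E M → ∃ h : V → V, ∀ p ∈ M, h p.1 = p.2 := by
      intro M hM
      refine ⟨fun d => if h : ∃ p ∈ M, p.1 = d then h.choose.2 else d, fun p hp => ?_⟩
      have h : ∃ q ∈ M, q.1 = p.1 := ⟨p, hp, rfl⟩
      have h' := h.choose_spec
      simp only [dif_pos h]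
      rw [hM.fst_injOn h'.1 hp h'.2]
    obtain ⟨f₁, hf₁⟩ := hpick M₁ hM₁
    obtain ⟨f₂, hf₂⟩ := hpick M₂ hM₂'
    have hsep : ∀ p ∈ M₂, p.1 ∉ M₁.image Prod.fst := fun p hp h =>
      hM₂.fst_notMem p hp (mem_union_right _ h)
    refine ⟨fun d => if d ∈ M₁.image Prod.fst then f₁ d else
      if d ∈ M₂.image Prod.fst then f₂ d else g d, ?_, ?_, ?_⟩
    · intro d hd hdE
      dsimp only
      split_ifs with h1 h2
      · obtain ⟨p, hp, rfl⟩ := mem_image.1 h1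
        rw [hf₁ p hp]; exact hM₁.adj p hp
      · obtain ⟨p, hp, rfl⟩ := mem_image.1 h2
        rw [hf₂ p hp]; exact hM₂.adj p hp
      · exact hg d
    · intro p hp
      dsimp only
      rw [if_pos (mem_image_of_mem _ hp), hf₁ p hp]
    · intro p hp
      dsimp only
      rw [if_neg (hsep p hp), if_pos (mem_image_of_mem _ hp), hf₂ p hp]
  obtain ⟨f, hfadj, hf₁, hf₂⟩ := hf
  -- Each vertex of `D` outside `E` is exchanged for a neighbour, the partner if it is matched.
  set F := E ∪ (D \ E).image f with hF
  have hfF : ∀ d ∈ D, d ∉ E → f d ∈ F := fun d hd hdE =>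
    mem_union_right _ (mem_image_of_mem _ (mem_sdiff.2 ⟨hd, hdE⟩))
  have hFc : F.card ≤ D.card := by
    have h1 := card_union_le E ((D \ E).image f)
    have h2 := card_image_le (s := D \ E) (f := f)
    have h3 := card_sdiff_add_card_eq_card hED
    rw [hF]
    omega
  have hM₁F : ∀ p ∈ M₁, p.2 ∈ F := fun p hp => by
    rw [← hf₁ p hp]; exact hfF _ (hM₁.fst_mem p hp) (hM₁.fst_notMem p hp)
  have hM₂F : ∀ p ∈ M₂, p.2 ∈ F := fun p hp => by
    rw [← hf₂ p hp]; exact hfF _ (hM₂.fst_mem p hp) (hM₂'.fst_notMem p hp)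
  have hFdom : IsDominatingSet G F := by
    intro y hy
    by_contra! hcon
    have hyD : y ∉ D := fun hyD => hcon _ (hfF y hyD fun h => hy (mem_union_left _ h))
      (hfadj y hyD fun h => hy (mem_union_left _ h))
    have hyE : ∀ e ∈ E, ¬ G.Adj e y := fun e he h => hcon e (mem_union_left _ he) h.symm
    obtain ⟨d, hd, hdy⟩ := hD y hyD
    have hdE : d ∉ E := fun h => hyE d h hdy.symm
    have key : ∀ M, IsMatchingFrom G D E M → M.card = s → (∀ p ∈ M, p.2 ∈ F) →
        ∃ p ∈ M, G.Adj p.1 y := by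
      intro M hM hMc hMF
      refine exists_adj_of_maximum hM (fun M' hM' => hMc ▸ hsmax M' hM') hd hyD hdy.symm hyE
        (fun p hp h => hcon _ (hMF p hp) h.symm) fun p hp hne h => ?_
      exact hdisj d hd hdE p.1 (hM.fst_mem p hp) (hM.fst_notMem p hp) hne.symm _ h (hM.adj p hp)
    -- An undominated `y` would be adjacent to a near end of `M₁` and to a different one of `M₂`,
    -- against the disjointness of neighbourhoods.
    obtain ⟨p, hp, hpy⟩ := key M₁ hM₁ hc₁ hM₁F
    obtain ⟨q, hq, hqy⟩ := key M₂ hM₂' hc₂ hM₂F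
    refine hdisj p.1 (hM₁.fst_mem p hp) (hM₁.fst_notMem p hp) q.1 (hM₂.fst_mem q hq)
      (hM₂'.fst_notMem q hq) (fun h => ?_) y hpy hqy
    exact hM₂.fst_notMem q hq (mem_union_right _ (mem_image.2 ⟨p, hp, h⟩))
  have hFind := hind F hFdom hFc
  -- As `F` contains no edge, the exchanged pairs form an induced matching, which bounds `D \ E`.
  have hmatch : IsMatchingFrom G D ∅ ((D \ E).image fun d => (d, f d)) := by
    constructor
    · simp only [mem_image, mem_sdiff]; rintro _ ⟨d, ⟨hd, -⟩, rfl⟩; exact hd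
    · simp
    · simp only [mem_image, mem_sdiff]; rintro _ ⟨d, ⟨hd, hdE⟩, rfl⟩
      exact hnot d hd _ (hfadj d hd hdE)
    · simp only [mem_image, mem_sdiff]; rintro _ ⟨d, ⟨hd, hdE⟩, rfl⟩
      exact hfadj d hd hdE
    · simp
    · simp only [mem_image, mem_sdiff]
      rintro _ ⟨d, ⟨hd, hdE⟩, rfl⟩ _ ⟨d', ⟨hd', hdE'⟩, rfl⟩ hne h
      exact hdisj d hd hdE d' hd' hdE' (fun h => hne (by rw [h])) _ h (hfadj d' hd' hdE')
    · simp only [mem_image, mem_sdiff]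
      rintro _ ⟨d, ⟨hd, hdE⟩, rfl⟩ _ ⟨d', ⟨hd', hdE'⟩, rfl⟩ hne h
      exact hFind ⟨_, hfF d hd hdE, _, hfF d' hd' hdE', h⟩
  have h1 := hK _ hmatch
  rw [card_image_of_injective _ fun a b h => (Prod.mk.inj h).1] at h1
  have h3 := card_sdiff_add_card_eq_card hED
  omega

end Bounded

end EdgeContraction

/-! ### Cutting a graph into clusters along an induced matching -/

namespace EdgeContraction

open Finset

section Cluster

variable {V ι : Type*} {G : SimpleGraph V}

/-- The edges `a i – b i` are pairwise disjoint and pairwise not joined by an edge. -/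
structure IsInducedMatching (G : SimpleGraph V) (a b : ι → V) : Prop where
  adj : ∀ i, G.Adj (a i) (b i)
  fst_fst : ∀ i j, i ≠ j → ¬ G.Adj (a i) (a j)
  fst_snd : ∀ i j, i ≠ j → ¬ G.Adj (a i) (b j)
  snd_snd : ∀ i j, i ≠ j → ¬ G.Adj (b i) (b j)

theorem IsInducedMatching.comp {κ : Type*} {a b : ι → V} (h : IsInducedMatching G a b) {e : κ → ι}
    (he : Function.Injective e) : IsInducedMatching G (a ∘ e) (b ∘ e) :=
  ⟨fun _ => h.adj _, fun _ _ hij => h.fst_fst _ _ (he.ne hij), fun _ _ hij => h.fst_snd _ _ (he.ne hij),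
    fun _ _ hij => h.snd_snd _ _ (he.ne hij)⟩

theorem not_inducedFree {k : ℕ} {x y z : V} {a b : Fin k → V} (hxy : G.Adj x y) (hyz : G.Adj y z)
    (hne : x ≠ z) (hxz : ¬ G.Adj x z) (hM : IsInducedMatching G a b)
    (ha : ∀ v, v = x ∨ v = y ∨ v = z → ∀ i, ¬ G.Adj v (a i))
    (hb : ∀ v, v = x ∨ v = y ∨ v = z → ∀ i, ¬ G.Adj v (b i)) : ¬ InducedFree (P3kP2 k) G := by
  have hva : ∀ v, v = x ∨ v = y ∨ v = z → ∀ i, v ≠ a i := by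
    rintro v hv i rfl; exact hb _ hv i (hM.adj i)
  have hvb : ∀ v, v = x ∨ v = y ∨ v = z → ∀ i, v ≠ b i := by
    rintro v hv i rfl; exact ha _ hv i (hM.adj i).symm
  let p : Fin 3 → V := ![x, y, z]
  let q : Fin k × Fin 2 → V := fun i => if i.2 = 0 then a i.1 else b i.1
  have hp : ∀ i, p i = x ∨ p i = y ∨ p i = z := by
    intro i; fin_cases i <;> simp [p]
  have hq : ∀ i, q i = a i.1 ∨ q i = b i.1 := by
    intro i; by_cases h : i.2 = 0 <;> simp [q, h]
  have hpp : ∀ i j, G.Adj (p i) (p j) ↔ (SimpleGraph.pathGraph 3).Adj i j := by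
    intro i j
    have hzx : ¬ G.Adj z x := fun h => hxz (G.adj_symm h)
    rw [SimpleGraph.pathGraph_adj]
    fin_cases i <;> fin_cases j <;> simp [p, hxy, hyz, hxz, hzx, hxy.symm, hyz.symm]
  have hpinj : Function.Injective p := by
    intro i j
    have := hxy.ne; have := hyz.ne
    fin_cases i <;> fin_cases j <;> simp [p, hxy.ne, hyz.ne, hne, hxy.ne', hyz.ne', hne.symm]
  have hpq : ∀ i j, ¬ G.Adj (p i) (q j) := by
    intro i j
    rcases hq j with h | h <;> rw [h]
    · exact ha _ (hp i) _
    · exact hb _ (hp i) _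
  have hpqn : ∀ i j, p i ≠ q j := by
    intro i j
    rcases hq j with h | h <;> rw [h]
    · exact hva _ (hp i) _
    · exact hvb _ (hp i) _
  have hqq : ∀ i j, G.Adj (q i) (q j) ↔ i.1 = j.1 ∧ (SimpleGraph.pathGraph 2).Adj i.2 j.2 := by
    rintro ⟨i, i'⟩ ⟨j, j'⟩
    rw [SimpleGraph.pathGraph_adj]
    by_cases hij : i = j
    · subst hij
      fin_cases i' <;> fin_cases j' <;> simp [q, hM.adj i, (hM.adj i).symm]
    · have h1 := hM.fst_fst i j hij
      have h2 := hM.fst_snd i j hij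
      have h3 := hM.fst_snd j i (Ne.symm hij)
      have h4 := hM.snd_snd i j hij
      rw [G.adj_comm] at h3
      fin_cases i' <;> fin_cases j' <;> simp [q, hij, h1, h2, h3, h4]
  have hqinj : Function.Injective q := by
    rintro ⟨i, i'⟩ ⟨j, j'⟩ h
    have hij : i = j := by
      by_contra hij
      have h1 : G.Adj (q (i, i')) (q (i, 1 - i')) := by
        rw [hqq, SimpleGraph.pathGraph_adj]; fin_cases i' <;> simp
      rw [h, hqq] at h1
      exact hij h1.1.symm
    subst hij
    have := (hM.adj i).ne
    have := (hM.adj i).ne'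
    fin_cases i' <;> fin_cases j' <;> simp_all [q]
  refine fun hfree => hfree ⟨⟨⟨Sum.elim p q, ?_⟩, ?_⟩⟩
  · rintro (i | i) (j | j) h
    · rw [hpinj h]
    · exact absurd h (hpqn i j)
    · exact absurd h.symm (hpqn j i)
    · rw [hqinj h]
  · rintro (i | i) (j | j)
    · exact hpp i j
    · exact iff_of_false (hpq i j) (by simp [P3kP2])
    · exact iff_of_false (fun h => hpq j i (G.adj_symm h)) (by simp [P3kP2])
    · exact hqq i j

/-- Equal or adjacent. -/
def Near (G : SimpleGraph V) (x y : V) : Prop := x = y ∨ G.Adj x y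

theorem Near.symm {x y : V} (h : Near G x y) : Near G y x :=
  h.imp Eq.symm fun h => G.adj_symm h

theorem Near.refl (x : V) : Near G x x := Or.inl rfl

/-- `x` is a vertex outside `U` that is equal or adjacent to `r`. -/
def InCluster (G : SimpleGraph V) (U : Set V) (r x : V) : Prop := x ∉ U ∧ Near G r x

/-- `u` misses at least two vertices of the cluster of `r`. -/
def IsBad (G : SimpleGraph V) (U : Set V) (u r : V) : Prop :=
  ∃ x y, InCluster G U r x ∧ InCluster G U r y ∧ x ≠ y ∧ ¬ G.Adj u x ∧ ¬ G.Adj u y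

/-- `G` is `(P₃ + k P₂)`-free, `G - U` is a disjoint union of cliques, and each vertex of `U` misses
at most one vertex of each of these cliques, up to `k + 1` exceptions. -/
structure IsClusterCut (G : SimpleGraph V) (k : ℕ) (U : Set V) : Prop where
  free : InducedFree (P3kP2 k) G
  trans : ∀ x y z, x ∉ U → y ∉ U → z ∉ U → G.Adj x y → G.Adj y z → x ≠ z → G.Adj x z
  bad_le : ∀ u ∈ U, ∀ B : Finset V, (∀ r ∈ B, r ∉ U) → (∀ r ∈ B, ∀ r' ∈ B, ¬ G.Adj r r') →
    (∀ r ∈ B, IsBad G U u r) → B.card ≤ k + 1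

variable {k : ℕ} {U : Set V}

theorem IsClusterCut.near_trans (h : IsClusterCut G k U) {x y z : V} (hx : x ∉ U) (hy : y ∉ U)
    (hz : z ∉ U) (hxy : Near G x y) (hyz : Near G y z) : Near G x z := by
  rcases hxy with rfl | hxy
  · exact hyz
  rcases hyz with rfl | hyz
  · exact Or.inr hxy
  by_cases hxz : x = z
  · exact Or.inl hxz
  · exact Or.inr (h.trans x y z hx hy hz hxy hyz hxz)

theorem IsClusterCut.near (h : IsClusterCut G k U) {r x y : V} (hr : r ∉ U)
    (hx : InCluster G U r x) (hy : InCluster G U r y) : Near G x y :=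
  h.near_trans hx.1 hr hy.1 hx.2.symm hy.2

theorem IsClusterCut.near_center (h : IsClusterCut G k U) {r r' x y : V} (hr : r ∉ U) (hr' : r' ∉ U)
    (hx : InCluster G U r x) (hy : InCluster G U r' y) (hxy : Near G x y) : Near G r r' :=
  h.near_trans hr hx.1 hr' hx.2 (h.near_trans hx.1 hy.1 hr' hxy hy.2.symm)

/-- The vertices with neighbours in two different edges of the matching `a i – b i`. -/
def touchingTwo (G : SimpleGraph V) (a b : ι → V) : Set V :=
  {u | ∃ i j, i ≠ j ∧ (G.Adj u (a i) ∨ G.Adj u (b i)) ∧ (G.Adj u (a j) ∨ G.Adj u (b j))}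

theorem IsInducedMatching.fst_notMem {a b : ι → V} (h : IsInducedMatching G a b) (i : ι) :
    a i ∉ touchingTwo G a b := by
  rintro ⟨j, l, hjl, hj, hl⟩
  have key : ∀ j, G.Adj (a i) (a j) ∨ G.Adj (a i) (b j) → i = j := by
    intro j hj
    by_contra hij
    exact hj.elim (h.fst_fst i j hij) (h.fst_snd i j hij)
  exact hjl ((key j hj).symm.trans (key l hl))

theorem IsInducedMatching.snd_notMem {a b : ι → V} (h : IsInducedMatching G a b) (i : ι) :
    b i ∉ touchingTwo G a b := by
  rintro ⟨j, l, hjl, hj, hl⟩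
  have key : ∀ j, G.Adj (b i) (a j) ∨ G.Adj (b i) (b j) → i = j := by
    intro j hj
    by_contra hij
    exact hj.elim (fun h' => h.fst_snd j i (Ne.symm hij) h'.symm) (h.snd_snd i j hij)
  exact hjl ((key j hj).symm.trans (key l hl))

theorem exists_fin_of_card {α : Type*} (B : Finset α) {n : ℕ} (h : n ≤ B.card) :
    ∃ e : Fin n → α, Function.Injective e ∧ ∀ i, e i ∈ B :=
  ⟨fun i => (B.equivFin.symm (Fin.castLE h i)).1, fun i j hij => by
    simpa using Subtype.ext hij, fun i => Subtype.prop _⟩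

/-- Each vertex outside `U` has neighbours in at most one matching edge, so an induced path on three
such vertices leaves `k` of the `k + 3` edges untouched. A vertex of `U` is the middle of an induced
path between two matching edges. If it had `k + 2` bad clusters, at most two would contain an end of
the path, and each of the others has an edge that the path does not touch. -/
theorem IsInducedMatching.isClusterCut {m : ℕ} {a b : Fin m → V} (h : IsInducedMatching G a b)
    (hfree : InducedFree (P3kP2 k) G) (hm : k + 3 ≤ m) : IsClusterCut G k (touchingTwo G a b) := by
  classical
  have htrans : ∀ x y z, x ∉ touchingTwo G a b → y ∉ touchingTwo G a b → z ∉ touchingTwo G a b →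
      G.Adj x y → G.Adj y z → x ≠ z → G.Adj x z := by
    intro x y z hx hy hz hxy hyz hne
    by_contra hxz
    let T : V → Finset (Fin m) := fun v => univ.filter fun i => G.Adj v (a i) ∨ G.Adj v (b i)
    have hT : ∀ v, v ∉ touchingTwo G a b → (T v).card ≤ 1 := by
      intro v hv
      refine card_le_one.2 fun i hi j hj => ?_
      by_contra hij
      exact hv ⟨i, j, hij, by simpa [T] using hi, by simpa [T] using hj⟩
    have h1 := hT x hx
    have h2 := hT y hy
    have h3 := hT z hz
    have h4 := card_union_le (T x) (T y ∪ T z)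
    have h5 := card_union_le (T y) (T z)
    have h6 := card_compl (T x ∪ (T y ∪ T z))
    rw [Fintype.card_fin] at h6
    obtain ⟨e, he, heB⟩ := exists_fin_of_card (n := k) (T x ∪ (T y ∪ T z))ᶜ (by omega)
    have hno : ∀ v, v = x ∨ v = y ∨ v = z → ∀ i, ¬ (G.Adj v (a (e i)) ∨ G.Adj v (b (e i))) := by
      intro v hv i hadj
      have := heB i
      simp only [compl_union, mem_inter, mem_compl, mem_filter, mem_univ, true_and, T] at this
      rcases hv with rfl | rfl | rfl <;> tauto
    exact not_inducedFree hxy hyz hne hxz (h.comp he) (fun v hv i h => hno v hv i (Or.inl h))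
      (fun v hv i h => hno v hv i (Or.inr h)) hfree
  refine ⟨hfree, htrans, ?_⟩
  intro u hu B hBU hBind hBbad
  by_contra! hcard
  -- auxiliary cut to use the clique structure
  have near_trans : ∀ x y z, x ∉ touchingTwo G a b → y ∉ touchingTwo G a b →
      z ∉ touchingTwo G a b → Near G x y → Near G y z → Near G x z := by
    intro x y z hx hy hz hxy hyz
    rcases hxy with rfl | hxy
    · exact hyz
    rcases hyz with rfl | hyz
    · exact Or.inr hxy
    by_cases hxz : x = z
    · exact Or.inl hxz
    · exact Or.inr (htrans x y z hx hy hz hxy hyz hxz)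
  have hBnear : ∀ r ∈ B, ∀ r' ∈ B, Near G r r' → r = r' := fun r hr r' hr' h =>
    h.resolve_right (hBind r hr r' hr')
  have hdiff : ∀ r ∈ B, ∀ r' ∈ B, ∀ x y, InCluster G (touchingTwo G a b) r x →
      InCluster G (touchingTwo G a b) r' y → Near G x y → r = r' := by
    intro r hr r' hr' x y hx hy hxy
    exact hBnear r hr r' hr' (near_trans _ _ _ (hBU r hr) hx.1 (hBU r' hr') hx.2
      (near_trans _ _ _ hx.1 hy.1 (hBU r' hr') hxy hy.2.symm))
  have hpick : ∀ i, (G.Adj u (a i) ∨ G.Adj u (b i)) →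
      ∃ v, v ∉ touchingTwo G a b ∧ G.Adj u v ∧ (v = a i ∨ v = b i) := by
    rintro i (hi | hi)
    · exact ⟨_, h.fst_notMem i, hi, Or.inl rfl⟩
    · exact ⟨_, h.snd_notMem i, hi, Or.inr rfl⟩
  obtain ⟨i, j, hij, hi, hj⟩ := hu
  obtain ⟨v, hvU, huv, hv⟩ := hpick i hi
  obtain ⟨w, hwU, huw, hw⟩ := hpick j hj
  have hvw : ¬ Near G v w := by
    have h1 := h.fst_fst i j hij
    have h2 := h.fst_snd i j hij
    have h3 := h.fst_snd j i hij.symm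
    have h4 := h.snd_snd i j hij
    have h5 := h.adj i
    have h6 := h.adj j
    rw [G.adj_comm] at h3
    rintro (rfl | hn)
    · rcases hv with rfl | rfl <;> rcases hw with hw | hw
      · rw [hw] at h2; exact h2 h6
      · rw [hw, G.adj_comm] at h1; exact h1 h6
      · rw [hw] at h4; exact h4 h6
      · rw [hw, G.adj_comm] at h3; exact h3 h6
    · rcases hv with rfl | rfl <;> rcases hw with rfl | rfl <;> contradiction
  let C : V → Finset V := fun x => B.filter fun r => Near G r x
  have hC : ∀ x, x ∉ touchingTwo G a b → (C x).card ≤ 1 := by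
    intro x hx
    refine card_le_one.2 fun r hr r' hr' => ?_
    simp only [C, mem_filter] at hr hr'
    exact hdiff r hr.1 r' hr'.1 x x ⟨hx, hr.2⟩ ⟨hx, hr'.2⟩ (Near.refl x)
  have h1 := hC v hvU
  have h2 := hC w hwU
  have h3 := card_union_le (C v) (C w)
  have h4 := card_le_card_sdiff_add_card (s := B) (t := C v ∪ C w)
  obtain ⟨e, he, heB⟩ := exists_fin_of_card (n := k) (B \ (C v ∪ C w)) (by omega)
  have heB' : ∀ l, e l ∈ B := fun l => (mem_sdiff.1 (heB l)).1
  have hfar : ∀ l x, InCluster G (touchingTwo G a b) (e l) x → ¬ G.Adj v x ∧ ¬ G.Adj w x := by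
    intro l x hx
    have hl := heB l
    simp only [mem_sdiff, mem_union, C, mem_filter, not_or, not_and] at hl
    exact ⟨fun hadj => hl.2.1 hl.1 (near_trans _ _ _ (hBU _ hl.1) hx.1 hvU hx.2 (Or.inr hadj.symm)),
      fun hadj => hl.2.2 hl.1 (near_trans _ _ _ (hBU _ hl.1) hx.1 hwU hx.2 (Or.inr hadj.symm))⟩
  choose x y hx hy hxy hux huy using fun l => hBbad _ (heB' l)
  have hne : ∀ l l', l ≠ l' → ∀ x y, InCluster G (touchingTwo G a b) (e l) x →
      InCluster G (touchingTwo G a b) (e l') y → ¬ G.Adj x y := fun l l' hll x y hx hy hadj =>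
    hll (he (hdiff _ (heB' l) _ (heB' l') x y hx hy (Or.inr hadj)))
  refine not_inducedFree (k := k) (a := x) (b := y) huv.symm huw (fun h => hvw (Or.inl h))
    (fun h => hvw (Or.inr h)) ⟨?_, ?_, ?_, ?_⟩ ?_ ?_ hfree
  · intro l
    exact (near_trans _ _ _ (hx l).1 (hBU _ (heB' l)) (hy l).1 (hx l).2.symm (hy l).2).resolve_left
      (hxy l)
  · exact fun l l' hll => hne l l' hll _ _ (hx l) (hx l')
  · exact fun l l' hll => hne l l' hll _ _ (hx l) (hy l')
  · exact fun l l' hll => hne l l' hll _ _ (hy l) (hy l')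
  · rintro _ (rfl | rfl | rfl) l
    exacts [(hfar l _ (hx l)).1, hux l, (hfar l _ (hx l)).2]
  · rintro _ (rfl | rfl | rfl) l
    exacts [(hfar l _ (hy l)).1, huy l, (hfar l _ (hy l)).2]

end Cluster

end EdgeContraction

/-! ### Choosing representatives of clusters so that they dominate `U` -/

namespace EdgeContraction

open Finset

section Push

variable {V : Type*} {G : SimpleGraph V} {k : ℕ} {U : Set V}

/-- Missing two chosen vertices makes a cluster bad. Consequently a vertex of `U` that misses many
`w i` is adjacent to all but `k + 1` of the corresponding `v i`. -/
theorem IsClusterCut.card_bad_le {ι : Type*} [Fintype ι] (h : IsClusterCut G k U) {r v w : ι → V}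
    (hr : Function.Injective r) (hrU : ∀ i, r i ∉ U) (hri : ∀ i j, ¬ G.Adj (r i) (r j))
    (hv : ∀ i, InCluster G U (r i) (v i)) (hw : ∀ i, InCluster G U (r i) (w i))
    (hvw : ∀ i, v i ≠ w i) {u : V} (hu : u ∈ U) (I : Finset ι) (hI : ∀ i ∈ I, ¬ G.Adj u (v i))
    (hI' : ∀ i ∈ I, ¬ G.Adj u (w i)) : I.card ≤ k + 1 := by
  classical
  rw [← card_image_of_injective I hr]
  refine h.bad_le u hu _ ?_ ?_ ?_
  · simp only [mem_image]; rintro _ ⟨i, -, rfl⟩; exact hrU i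
  · simp only [mem_image]; rintro _ ⟨i, -, rfl⟩ _ ⟨j, -, rfl⟩; exact hri i j
  · simp only [mem_image]; rintro _ ⟨i, hi, rfl⟩
    exact ⟨v i, w i, hv i, hw i, hvw i, hI i hi, hI' i hi⟩

open Classical in
/-- A vertex `u₀ ∈ U` dominates all but one vertex of most clusters, which leaves so much freedom in
the choice of representatives of the clusters that some choice dominates `U`. -/
theorem IsClusterCut.exists_dominating_hasEdge (h : IsClusterCut G k U) {S R Q : Finset V} {u₀ : V}
    (hu₀S : u₀ ∈ S) (hu₀ : u₀ ∈ U) (hR : ∀ r ∈ R, r ∉ U) (hRi : ∀ r ∈ R, ∀ r' ∈ R, ¬ G.Adj r r')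
    (hdom : ∀ y, y ∉ U → ∃ x ∈ S ∪ R, Near G y x) (hQR : Q ⊆ R)
    (hQ : ∀ r ∈ Q, ∃ x, x ∉ U ∧ G.Adj r x)
    (hc : (k + 1) * (k + 3) + (2 * k + 6) + (k + 1) ≤ Q.card) :
    ∃ D, IsDominatingSet G D ∧ HasEdge G D ∧ D.card ≤ S.card + R.card := by
  -- Block `0` will supply the ends of the path, block `p ≥ 1` an end of the `p`-th matching edge.
  -- With `k + 3` clusters in a block, two survive `k + 1` exceptions. The last `2k + 6` clusters
  -- are a reserve, of which at least `k + 1` survive. The final `k + 1` in `hc` pays for the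
  -- clusters that are bad for `u₀`.
  let ι := Fin (k + 1) × Fin (k + 3) ⊕ Fin (2 * k + 6)
  obtain ⟨r, hrinj, hrQ, hrgood⟩ : ∃ r : ι → V, Function.Injective r ∧ (∀ i, r i ∈ Q) ∧
      ∀ i, ¬ IsBad G U u₀ (r i) := by
    have h1 : (Q.filter (IsBad G U u₀)).card ≤ k + 1 := by
      refine h.bad_le u₀ hu₀ _ (fun r hr => hR r (hQR (mem_filter.1 hr).1))
        (fun r hr r' hr' => hRi r (hQR (mem_filter.1 hr).1) r' (hQR (mem_filter.1 hr').1))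
        fun r hr => (mem_filter.1 hr).2
    have h2 := card_filter_add_card_filter_not (s := Q) (IsBad G U u₀)
    have h3 : Fintype.card ι = (k + 1) * (k + 3) + (2 * k + 6) := by simp [ι]
    obtain ⟨e, he, heQ⟩ := exists_fin_of_card (n := Fintype.card ι)
      (Q.filter fun r => ¬ IsBad G U u₀ r) (by omega)
    refine ⟨e ∘ Fintype.equivFin ι, he.comp (Equiv.injective _), fun i => ?_, fun i => ?_⟩
    · exact (mem_filter.1 (heQ _)).1
    · exact (mem_filter.1 (heQ _)).2
  have hrR : ∀ i, r i ∈ R := fun i => hQR (hrQ i)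
  have hrU : ∀ i, r i ∉ U := fun i => hR _ (hrR i)
  have hri : ∀ i j, ¬ G.Adj (r i) (r j) := fun i j => hRi _ (hrR i) _ (hrR j)
  -- `v i` is the one vertex of the cluster that `u₀` misses, if there is one; all others, such as
  -- `w i`, are adjacent to `u₀`.
  have hvw : ∀ i, ∃ v w, InCluster G U (r i) v ∧ InCluster G U (r i) w ∧ v ≠ w ∧
      ∀ x, InCluster G U (r i) x → x ≠ v → G.Adj u₀ x := by
    intro i
    obtain ⟨x, hxU, hx⟩ := hQ _ (hrQ i)
    have hself : InCluster G U (r i) (r i) := ⟨hrU i, Near.refl _⟩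
    have hxc : InCluster G U (r i) x := ⟨hxU, Or.inr hx⟩
    have hother : ∀ v, ∃ w, InCluster G U (r i) w ∧ v ≠ w := by
      intro v
      by_cases hv : v = r i
      · exact ⟨x, hxc, hv ▸ hx.ne⟩
      · exact ⟨r i, hself, hv⟩
    by_cases hm : ∃ v, InCluster G U (r i) v ∧ ¬ G.Adj u₀ v
    · obtain ⟨v, hv, huv⟩ := hm
      obtain ⟨w, hw, hvw⟩ := hother v
      refine ⟨v, w, hv, hw, hvw, fun y hy hyv => ?_⟩
      by_contra hy'
      exact hrgood i ⟨y, v, hy, hv, hyv, hy', huv⟩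
    · push Not at hm
      exact ⟨r i, x, hself, hxc, hx.ne, fun y hy _ => hm y hy⟩
  choose v w hv hw hvw hu₀v using hvw
  have hu₀w : ∀ i, G.Adj u₀ (w i) := fun i => hu₀v i _ (hw i) (hvw i).symm
  by_contra! hcon
  -- a choice of representatives that leaves room for the vertices of `T`
  have step : ∀ (T : Finset V) (J : Finset ι) (ρ : ι → V), T.card ≤ J.card →
      (∀ i, InCluster G U (r i) (ρ i)) →
      (∀ j ∈ J, ∀ x, InCluster G U (r j) x → ∃ t ∈ S ∪ T, G.Adj x t) →
      (∃ j ∉ J, G.Adj u₀ (ρ j)) →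
      ∃ u ∈ U, (∀ t ∈ T, ¬ G.Adj u t) ∧ ∀ i ∉ J, ¬ G.Adj u (ρ i) := by
    rintro T J ρ hTJ hρ hJ ⟨j, hj, hjadj⟩
    -- Clusters in `J` are dominated by `S ∪ T` and need no representative, which pays for `T`. The
    -- resulting set has an edge at `u₀`, is small enough and dominates everything outside `U`; so
    -- it must fail at some vertex of `U`.
    by_contra! hall
    set D := S ∪ (T ∪ ((R \ univ.image r) ∪ Jᶜ.image ρ)) with hD
    have memρ : ∀ i ∉ J, ρ i ∈ D := fun i hi => by
      simp only [hD, mem_union, mem_image, mem_compl]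
      exact Or.inr (Or.inr (Or.inr ⟨i, hi, rfl⟩))
    have memT : ∀ t ∈ T, t ∈ D := fun t ht => by simp [hD, ht]
    have memS : ∀ t ∈ S, t ∈ D := fun t ht => by simp [hD, ht]
    have hDdom : IsDominatingSet G D := by
      intro y hy
      have near : ∀ x ∈ D, Near G y x → ∃ x ∈ D, G.Adj y x := fun x hx hyx =>
        ⟨x, hx, hyx.resolve_left fun h => hy (h ▸ hx)⟩
      by_cases hyU : y ∈ U
      · by_cases hyT : ∀ t ∈ T, ¬ G.Adj y t
        · obtain ⟨i, hi, hyi⟩ := hall y hyU hyT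
          exact ⟨_, memρ i hi, hyi⟩
        · push Not at hyT
          obtain ⟨t, ht, hyt⟩ := hyT
          exact ⟨t, memT t ht, hyt⟩
      · obtain ⟨x, hx, hyx⟩ := hdom y hyU
        rcases mem_union.1 hx with hx | hx
        · exact near x (memS x hx) hyx
        · by_cases hxr : ∃ i, r i = x
          · obtain ⟨i, rfl⟩ := hxr
            have hyc : InCluster G U (r i) y := ⟨hyU, hyx.symm⟩
            by_cases hi : i ∈ J
            · obtain ⟨t, ht, hyt⟩ := hJ i hi y hyc
              rcases mem_union.1 ht with ht | ht
              · exact ⟨t, memS t ht, hyt⟩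
              · exact ⟨t, memT t ht, hyt⟩
            · exact near _ (memρ i hi) (h.near (hrU i) hyc (hρ i))
          · refine near x ?_ hyx
            simp only [hD, mem_union, mem_sdiff, mem_image, mem_univ, true_and]
            exact Or.inr (Or.inr (Or.inl ⟨hx, hxr⟩))
    have hlt := hcon D hDdom ⟨u₀, memS _ hu₀S, _, memρ j hj, hjadj⟩
    have h1 := card_union_le S (T ∪ ((R \ univ.image r) ∪ Jᶜ.image ρ))
    have h2 := card_union_le T ((R \ univ.image r) ∪ Jᶜ.image ρ)
    have h3 := card_union_le (R \ univ.image r) (Jᶜ.image ρ)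
    have h4 : (univ.image r).card = Fintype.card ι := by
      rw [card_image_of_injective _ hrinj, card_univ]
    have h5 := card_sdiff_add_card_eq_card (s := univ.image r) (t := R) (by
      intro x hx
      simp only [mem_image, mem_univ, true_and] at hx
      obtain ⟨i, rfl⟩ := hx
      exact hrR i)
    have h6 := card_image_le (s := Jᶜ) (f := ρ)
    have h7 := card_compl_add_card J
    rw [← hD] at h1
    omega
  have hbad := fun {u : V} (hu : u ∈ U) (I : Finset ι) =>
    h.card_bad_le (ι := ι) hrinj hrU hri hv hw hvw hu I
  -- the middle of the path
  obtain ⟨z, hzU, -, hz⟩ := step ∅ ∅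
    (Sum.elim (fun p => if p.1 = 0 then w (.inl p) else v (.inl p)) fun j => w (.inr j)) le_rfl
    (by
      rintro (i | j)
      · simp only [Sum.elim_inl]; split_ifs <;> simp [hv, hw]
      · exact hw _) (by simp) ⟨.inr 0, by simp, hu₀w _⟩
  have hzw : ∀ q, ¬ G.Adj z (w (.inl (0, q))) := fun q => by simpa using hz (.inl (0, q)) (by simp)
  have hzv : ∀ p q, p ≠ 0 → ¬ G.Adj z (v (.inl (p, q))) := fun p q hp => by
    simpa [hp] using hz (.inl (p, q)) (by simp)
  have hzF : ∀ j, ¬ G.Adj z (w (.inr j)) := fun j => by simpa using hz (.inr j) (by simp)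
  -- Since `z` misses `w` on the reserve, it meets `v` on at least `k + 1` reserve clusters. There
  -- `u₀` and `z` dominate the whole cluster, so its representative can be dropped.
  obtain ⟨e, he, heF⟩ : ∃ e : Fin (k + 1) → ι, Function.Injective e ∧
      ∀ i, (∃ j, e i = .inr j) ∧ G.Adj z (v (e i)) := by
    have h1 := hbad hzU ((univ.map ⟨Sum.inr, Sum.inr_injective⟩).filter fun i => ¬ G.Adj z (v i))
      (fun i hi => (mem_filter.1 hi).2) (fun i hi => by
        simp only [mem_filter, mem_map, mem_univ, true_and] at hi
        obtain ⟨⟨j, rfl⟩, -⟩ := hi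
        exact hzF j)
    have h2 := card_filter_add_card_filter_not
      (s := (univ : Finset (Fin (2 * k + 6))).map
        (⟨Sum.inr, Sum.inr_injective⟩ : Fin (2 * k + 6) ↪ ι)) fun i => G.Adj z (v i)
    rw [card_map, card_univ, Fintype.card_fin] at h2
    obtain ⟨e, he, heF⟩ := exists_fin_of_card (n := k + 1) (((univ : Finset (Fin (2 * k + 6))).map
      (⟨Sum.inr, Sum.inr_injective⟩ : Fin (2 * k + 6) ↪ ι)).filter fun i => G.Adj z (v i)) (by omega)
    refine ⟨e, he, fun i => ?_⟩
    have := heF i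
    simp only [mem_filter, mem_map, mem_univ, true_and] at this
    exact ⟨this.1.imp fun j hj => hj.symm, this.2⟩
  -- the matching edges
  have build : ∀ t ≤ k, ∃ u : ℕ → V, ∀ s, 1 ≤ s → s ≤ t → u s ∈ U ∧ ¬ G.Adj (u s) z ∧
      (∀ s', 1 ≤ s' → s' < s → ¬ G.Adj (u s) (u s')) ∧
      (∀ p : Fin (k + 1), ∀ q, p.1 = s → ¬ G.Adj (u s) (w (.inl (p, q)))) ∧
      ∀ p : Fin (k + 1), ∀ q, p.1 ≠ s → ¬ G.Adj (u s) (v (.inl (p, q))) := by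
    intro t
    induction t with
    | zero => exact fun _ => ⟨fun _ => z, fun s h1 h2 => by omega⟩
    | succ t ih =>
      intro ht
      obtain ⟨u, hu⟩ := ih (by omega)
      -- Adding the vertices found so far makes the next undominated vertex nonadjacent to them.
      -- They are paid for by `t + 1 ≤ k` reserve clusters; the last one is never dropped and keeps
      -- the edge at `u₀`.
      set T := insert z ((Finset.Icc 1 t).image u) with hT
      set J : Finset ι := (univ : Finset (Fin (t + 1))).image fun i => e (Fin.castLE (by omega) i)
        with hJ
      have hJc : J.card = t + 1 := by
        rw [hJ, card_image_of_injective _ fun a b hab => Fin.castLE_injective _ (he hab)]; simp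
      have hTc : T.card ≤ t + 1 := by
        have h1 := card_insert_le z ((Finset.Icc 1 t).image u)
        have h2 := card_image_le (s := Finset.Icc 1 t) (f := u)
        simp only [Nat.card_Icc] at h2
        rw [hT]
        omega
      have hJmem : ∀ j ∈ J, (∃ i, j = .inr i) ∧ G.Adj z (v j) := by
        intro j hj
        simp only [hJ, mem_image, mem_univ, true_and] at hj
        obtain ⟨i, rfl⟩ := hj
        exact heF _
      have hlast : e (Fin.last k) ∉ J := by
        simp only [hJ, mem_image, mem_univ, true_and, not_exists]
        intro i hi
        have := congrArg Fin.val (he hi)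
        simp only [Fin.val_castLE, Fin.val_last] at this
        omega
      have hinl : ∀ p, (.inl p : ι) ∉ J := fun p hp => by
        obtain ⟨⟨i, hi⟩, -⟩ := hJmem _ hp
        cases hi
      obtain ⟨x, hxU, hxT, hx⟩ := step T J
        (Sum.elim (fun p => if p.1.1 = t + 1 then w (.inl p) else v (.inl p)) fun j => w (.inr j))
        (by omega)
        (by
          rintro (i | j)
          · simp only [Sum.elim_inl]; split_ifs <;> simp [hv, hw]
          · exact hw _)
        (by
          intro j hj x hx
          by_cases hxv : x = v j
          · exact ⟨z, by simp [hT], hxv ▸ (hJmem j hj).2.symm⟩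
          · exact ⟨u₀, by simp [hu₀S], (hu₀v j x hx hxv).symm⟩)
        ⟨e (Fin.last k), hlast, by
          obtain ⟨⟨j, hj⟩, -⟩ := heF (Fin.last k)
          rw [hj]; exact hu₀w _⟩
      refine ⟨fun s => if s = t + 1 then x else u s, fun s hs1 hst => ?_⟩
      by_cases hs : s = t + 1
      · subst hs
        simp only [if_true]
        refine ⟨hxU, hxT z (by simp [hT]), fun s' h1 h2 => ?_, fun p q hp => ?_, fun p q hp => ?_⟩
        · rw [if_neg (by omega)]
          exact hxT _ (by
            simp only [hT, mem_insert, mem_image, Finset.mem_Icc]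
            exact Or.inr ⟨s', ⟨h1, by omega⟩, rfl⟩)
        · simpa [hp] using hx (.inl (p, q)) (hinl _)
        · simpa [hp] using hx (.inl (p, q)) (hinl _)
      · obtain ⟨h1, h2, h3, h4, h5⟩ := hu s hs1 (by omega)
        simp only [if_neg hs]
        refine ⟨h1, h2, fun s' hs1' hs' => ?_, h4, h5⟩
        rw [if_neg (by omega)]
        exact h3 s' hs1' hs'
  obtain ⟨u, hu⟩ := build k le_rfl
  -- a vertex of `U` that misses `w` on a block meets `v` on it
  have block : ∀ x ∈ U, ∀ p, (∀ q, ¬ G.Adj x (w (.inl (p, q)))) →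
      1 < (univ.filter fun q => G.Adj x (v (.inl (p, q)))).card := by
    intro x hx p hxw
    have h1 := hbad hx ((univ.filter fun q => ¬ G.Adj x (v (.inl (p, q)))).image
      fun q => .inl (p, q))
      (by simp only [mem_image, mem_filter, mem_univ, true_and]; rintro _ ⟨q, hq, rfl⟩; exact hq)
      (by simp only [mem_image, mem_filter, mem_univ, true_and]; rintro _ ⟨q, hq, rfl⟩; exact hxw q)
    rw [card_image_of_injective _ fun a b hab => (Prod.mk.inj (Sum.inl.inj hab)).2] at h1
    have h2 := card_filter_add_card_filter_not (s := (univ : Finset (Fin (k + 3))))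
      fun q => G.Adj x (v (.inl (p, q)))
    rw [card_univ, Fintype.card_fin] at h2
    omega
  obtain ⟨qa, ha, qb, hb, hab⟩ := one_lt_card.1 (block z hzU 0 hzw)
  simp only [mem_filter, mem_univ, true_and] at ha hb
  have hq : ∀ s : Fin k, ∃ q, G.Adj (u (s + 1)) (v (.inl (s.succ, q))) := by
    intro s
    obtain ⟨h1, -, -, h4, -⟩ := hu (s + 1) (by omega) (by omega)
    obtain ⟨q, hq⟩ := card_pos.1 (zero_lt_one.trans (block _ h1 s.succ fun q => h4 _ q (by simp)))
    exact ⟨q, by simpa using hq⟩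
  choose q hq using hq
  have hvv : ∀ i j, i ≠ j → ¬ Near G (v i) (v j) := fun i j hij hadj =>
    hij (hrinj ((h.near_center (hrU i) (hrU j) (hv i) (hv j) hadj).resolve_right (hri i j)))
  have huv : ∀ s : Fin k, ∀ p : Fin (k + 1), ∀ q, p ≠ s.succ →
      ¬ G.Adj (u (s + 1)) (v (.inl (p, q))) := by
    intro s p q hp
    refine (hu (s + 1) (by omega) (by omega)).2.2.2.2 p q fun h => hp (Fin.ext (by simpa using h))
  have huu : ∀ s s' : Fin k, s ≠ s' → ¬ G.Adj (u (s + 1)) (u (s' + 1)) := by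
    intro s s' hss
    rcases lt_or_gt_of_ne hss with hlt | hlt
    · exact fun hadj => (hu (s' + 1) (by omega) (by omega)).2.2.1 (s + 1) (by omega)
        (by simpa using hlt) hadj.symm
    · exact (hu (s + 1) (by omega) (by omega)).2.2.1 (s' + 1) (by omega) (by simpa using hlt)
  have hne : ∀ p p', p ≠ p' → (.inl p : ι) ≠ .inl p' := fun p p' h h' => h (Sum.inl.inj h')
  have hab' : (.inl (0, qa) : ι) ≠ .inl (0, qb) := hne _ _ (by simpa using hab)
  -- The vertices `v` lie in different clusters. The vertex `z` meets two of them in block `0` and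
  -- none in the other blocks, and `u (s + 1)` meets `v` only in block `s + 1`.
  refine not_inducedFree (k := k) (x := v (.inl (0, qa))) (y := z) (z := v (.inl (0, qb)))
    (a := fun s => v (.inl (s.succ, q s))) (b := fun s => u (s + 1)) ha.symm hb
    (fun h => hvv _ _ hab' (Or.inl h)) (fun h => hvv _ _ hab' (Or.inr h)) ⟨?_, ?_, ?_, ?_⟩ ?_ ?_ h.free
  · exact fun s => (hq s).symm
  · exact fun s s' hss hadj => hvv _ _ (hne _ _ (by simp [hss])) (Or.inr hadj)
  · exact fun s s' hss hadj => huv s' s.succ _ (by simpa using hss) hadj.symm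
  · exact huu
  · rintro _ (rfl | rfl | rfl) s
    · exact fun hadj => hvv _ _ (hne _ _ (by simp [Fin.ext_iff])) (Or.inr hadj)
    · exact hzv _ _ (Fin.succ_ne_zero _)
    · exact fun hadj => hvv _ _ (hne _ _ (by simp [Fin.ext_iff])) (Or.inr hadj)
  · rintro _ (rfl | rfl | rfl) s
    · exact fun hadj => huv s 0 _ (Fin.succ_ne_zero _).symm hadj.symm
    · exact fun hadj => (hu (s + 1) (by omega) (by omega)).2.1 hadj.symm
    · exact fun hadj => huv s 0 _ (Fin.succ_ne_zero _).symm hadj.symm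

end Push

end EdgeContraction

/-! ### Certificates and their soundness -/

namespace EdgeContraction

open Finset

section Certificate

variable {V : Type*} {G : SimpleGraph V} {k : ℕ} {U : Set V}

/-- Some `s` vertices of `U` together dominate some `s` different clusters. -/
def DominatesClusters (G : SimpleGraph V) (U : Set V) (s : ℕ) : Prop :=
  ∃ u y : Fin s → V, (∀ i, u i ∈ U) ∧ (∀ i, y i ∉ U) ∧ (∀ i j, i ≠ j → ¬ Near G (y i) (y j)) ∧
    ∀ j x, InCluster G U (y j) x → ∃ i, G.Adj x (u i)

theorem DominatesClusters.pair {u u' y y' : V} (hu : u ∈ U) (hu' : u' ∈ U) (hy : y ∉ U) (hy' : y' ∉ U)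
    (hne : ¬ Near G y y') (h : ∀ x, InCluster G U y x → G.Adj x u ∨ G.Adj x u')
    (h' : ∀ x, InCluster G U y' x → G.Adj x u ∨ G.Adj x u') : DominatesClusters G U 2 := by
  refine ⟨![u, u'], ![y, y'], ?_, ?_, ?_, ?_⟩
  · simp [Fin.forall_fin_two, hu, hu']
  · simp [Fin.forall_fin_two, hy, hy']
  · have hne' : ¬ Near G y' y := fun h => hne h.symm
    simp [Fin.forall_fin_two, hne, hne']
  · simpa [Fin.forall_fin_two, Fin.exists_fin_two] using ⟨h, h'⟩

/-- If some set `S ⊆ U` dominates at least `|S|` clusters, then so does one of bounded size. -/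
theorem IsClusterCut.exists_dominatesClusters (h : IsClusterCut G k U) {S L : Finset V}
    (hS : ∀ u ∈ S, u ∈ U) (hSne : S.Nonempty) (hL : ∀ y ∈ L, y ∉ U)
    (hLi : ∀ y ∈ L, ∀ y' ∈ L, y ≠ y' → ¬ Near G y y') (hc : S.card ≤ L.card)
    (hdom : ∀ y ∈ L, ∀ x, InCluster G U y x → ∃ u ∈ S, G.Adj x u) :
    ∃ s, 1 ≤ s ∧ s ≤ 3 * k + 5 ∧ DominatesClusters G U s := by
  classical
  have hLi' : ∀ y ∈ L, ∀ y' ∈ L, ¬ G.Adj y y' := fun y hy y' hy' hadj =>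
    hLi y hy y' hy' hadj.ne (Or.inr hadj)
  by_cases hsmall : S.card ≤ 3 * k + 5
  · obtain ⟨e, he, heL⟩ := exists_fin_of_card L hc
    refine ⟨S.card, card_pos.2 hSne, hsmall, fun i => (S.equivFin.symm i).1, e,
      fun i => hS _ (S.equivFin.symm i).2, fun i => hL _ (heL i), fun i j hij =>
      hLi _ (heL i) _ (heL j) (he.ne hij), fun j x hx => ?_⟩
    obtain ⟨u, hu, hxu⟩ := hdom _ (heL j) x hx
    exact ⟨S.equivFin ⟨u, hu⟩, by simpa using hxu⟩
  -- With more than `3k + 5` clusters, two vertices dominating two clusters can be found.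
  refine ⟨2, by omega, by omega, ?_⟩
  have hbad : ∀ u ∈ U, (L.filter (IsBad G U u)).card ≤ k + 1 := fun u hu =>
    h.bad_le u hu _ (fun r hr => hL r (mem_filter.1 hr).1)
      (fun r hr r' hr' => hLi' r (mem_filter.1 hr).1 r' (mem_filter.1 hr').1)
      fun r hr => (mem_filter.1 hr).2
  obtain ⟨u₁, hu₁⟩ := hSne
  by_contra hno
  set L' := L.filter fun y => ¬ IsBad G U u₁ y with hL'
  have hL'L : ∀ y ∈ L', y ∈ L := fun y hy => (mem_filter.1 hy).1
  have hL'c : 2 * k + 4 < L'.card := by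
    have h1 := hbad u₁ (hS _ hu₁)
    have h2 := card_filter_add_card_filter_not (s := L) (IsBad G U u₁)
    rw [hL']
    omega
  -- `v y` is the vertex of the cluster that `u₁` misses, if any, and `g y` repairs this.
  have hv : ∀ y, ∃ v g, y ∈ L' → InCluster G U y v ∧ g ∈ S ∧ G.Adj v g ∧
      ∀ x, InCluster G U y x → x ≠ v → G.Adj x u₁ := by
    intro y
    by_cases hy : y ∈ L'
    · by_cases hm : ∃ v, InCluster G U y v ∧ ¬ G.Adj u₁ v
      · obtain ⟨v, hv, huv⟩ := hm
        obtain ⟨g, hg, hvg⟩ := hdom y (hL'L y hy) v hv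
        refine ⟨v, g, fun _ => ⟨hv, hg, hvg, fun x hx hxv => ?_⟩⟩
        by_contra hx'
        exact (mem_filter.1 hy).2 ⟨x, v, hx, hv, hxv, fun h => hx' h.symm, huv⟩
      · push Not at hm
        have hself : InCluster G U y y := ⟨hL y (hL'L y hy), Near.refl _⟩
        exact ⟨y, u₁, fun _ => ⟨hself, hu₁, (hm y hself).symm, fun x hx _ => (hm x hx).symm⟩⟩
    · exact ⟨y, y, fun h => absurd h hy⟩
  choose v g hvg using hv
  -- for `y ≠ y'`, the vertex `g y` is bad for `y'` or `g y'` is bad for `y`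
  have hpair : ∀ y ∈ L', ∀ y' ∈ L', y ≠ y' → IsBad G U (g y) y' ∨ IsBad G U (g y') y := by
    intro y hy y' hy' hne
    by_contra! hgood
    have key : ∀ y ∈ L', ∀ y' ∈ L', y ≠ y' → ¬ IsBad G U (g y') y →
        ∀ x, InCluster G U y x → G.Adj x (g y) ∨ G.Adj x (g y') := by
      intro y hy y' hy' hne hnb x hx
      by_contra! hx'
      obtain ⟨hv, hgS, hvgy, hv1⟩ := hvg y hy
      obtain ⟨hv', hgS', hvgy', hv1'⟩ := hvg y' hy'
      have hxv : x ≠ v y := fun h => hx'.1 (h ▸ hvgy)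
      have hadj : G.Adj (v y) (g y') := by
        by_contra hadj
        exact hnb ⟨x, v y, hx, hv, hxv, fun h => hx'.2 h.symm, fun h => hadj h.symm⟩
      refine hno (.pair (hS _ hu₁) (hS _ hgS') (hL _ (hL'L _ hy)) (hL _ (hL'L _ hy'))
        (hLi _ (hL'L _ hy) _ (hL'L _ hy') hne) (fun z hz => ?_) fun z hz => ?_)
      · by_cases hzv : z = v y
        · exact Or.inr (hzv ▸ hadj)
        · exact Or.inl (hv1 z hz hzv)
      · by_cases hzv : z = v y'
        · exact Or.inr (hzv ▸ hvgy')
        · exact Or.inl (hv1' z hz hzv)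
    exact hno (.pair (hS _ (hvg y hy).2.1) (hS _ (hvg y' hy').2.1) (hL _ (hL'L _ hy))
      (hL _ (hL'L _ hy')) (hLi _ (hL'L _ hy) _ (hL'L _ hy') hne) (key y hy y' hy' hne hgood.2)
      fun x hx => (key y' hy' y hy hne.symm hgood.1 x hx).symm)
  -- Every ordered pair in `L'` is bad in one direction, but each `g y` has at most `k + 1` bad
  -- clusters. This gives `|L'| ≤ 2k + 3`.
  let B := L'.sigma fun y => L.filter (IsBad G U (g y))
  have hBc : B.card ≤ L'.card * (k + 1) := by
    rw [card_sigma]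
    exact sum_le_card_nsmul _ _ _ fun y hy => hbad _ (hS _ (hvg y hy).2.1)
  have hsub : L'.offDiag ⊆ (B.image fun p => (p.1, p.2)) ∪ B.image fun p => (p.2, p.1) := by
    rintro ⟨y, y'⟩ hyy
    obtain ⟨hy, hy', hne⟩ := mem_offDiag.1 hyy
    simp only [mem_union, mem_image, B, mem_sigma, mem_filter, Prod.mk.injEq, Sigma.exists]
    rcases hpair y hy y' hy' hne with hb | hb
    · exact Or.inl ⟨y, y', ⟨hy, hL'L _ hy', hb⟩, rfl, rfl⟩
    · exact Or.inr ⟨y', y, ⟨hy', hL'L _ hy, hb⟩, rfl, rfl⟩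
  have h1 := card_le_card hsub
  have h2 := card_union_le (B.image fun p => (p.1, p.2)) (B.image fun p => (p.2, p.1))
  have h3 := card_image_le (s := B) (f := fun p => (p.1, p.2))
  have h4 := card_image_le (s := B) (f := fun p => (p.2, p.1))
  rw [offDiag_card] at h1
  have h5 : L'.card * L'.card ≤ L'.card * (2 * (k + 1) + 1) := by
    have : L'.card * (2 * (k + 1) + 1) = 2 * (L'.card * (k + 1)) + L'.card := by ring
    omega
  have h6 := Nat.le_of_mul_le_mul_left h5 (by omega)
  omega

/-- A set of representatives of the clusters. -/
theorem exists_representatives [Finite V] (G : SimpleGraph V) (U : Set V) :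
    ∃ I : Finset V, (∀ i ∈ I, i ∉ U) ∧ (∀ i ∈ I, ∀ j ∈ I, i ≠ j → ¬ Near G i j) ∧
      ∀ x, x ∉ U → ∃ i ∈ I, Near G i x := by
  classical
  have := Fintype.ofFinite V
  obtain ⟨I, hI, hmax⟩ := exists_max_image (univ.filter fun I : Finset V =>
    (∀ i ∈ I, i ∉ U) ∧ ∀ i ∈ I, ∀ j ∈ I, i ≠ j → ¬ Near G i j) card ⟨∅, by simp⟩
  simp only [mem_filter, mem_univ, true_and] at hI hmax
  refine ⟨I, hI.1, hI.2, fun x hx => ?_⟩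
  by_contra! hcon
  have hxI : x ∉ I := fun h => hcon x h (Near.refl x)
  have := hmax (insert x I) ⟨?_, ?_⟩
  · rw [card_insert_of_notMem hxI] at this
    omega
  · simpa [hx] using hI.1
  · intro i hi j hj hij
    rw [mem_insert] at hi hj
    rcases hi with rfl | hi <;> rcases hj with rfl | hj
    · exact absurd rfl hij
    · exact fun h => hcon j hj h.symm
    · exact hcon i hi
    · exact hI.2 i hi j hj hij

/-- A dominating set that is no larger than the number of clusters consists of one vertex from each
cluster, unless some few vertices of `U` dominate as many clusters. -/
theorem IsClusterCut.not_hasEdge (h : IsClusterCut G k U)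
    (hno : ∀ s, 1 ≤ s → s ≤ 3 * k + 5 → ¬ DominatesClusters G U s) {I D : Finset V}
    (hIU : ∀ i ∈ I, i ∉ U) (hIi : ∀ i ∈ I, ∀ j ∈ I, i ≠ j → ¬ Near G i j)
    (hD : IsDominatingSet G D) (hc : D.card ≤ I.card) :
    ¬ HasEdge G D := by
  classical
  have hinj : ∀ (J : Finset V) (g : V → V), J ⊆ I → (∀ i ∈ J, InCluster G U i (g i)) →
      Set.InjOn g J := by
    intro J g hJ hg i hi j hj hij
    by_contra hne
    exact hIi i (hJ hi) j (hJ hj) hne (h.near_center (hIU i (hJ hi)) (hIU j (hJ hj)) (hg i hi)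
      (hg j hj) (Or.inl hij))
  set L := I.filter fun i => ∀ x ∈ D, ¬ InCluster G U i x with hL
  set S := D.filter (· ∈ U) with hS
  -- `D` spends a vertex outside `U` on each cluster not in `L`, so at most `|L|` vertices are left
  -- for `U`. The clusters in `L` are dominated from `S` alone.
  have hSL : S.card ≤ L.card := by
    have hg : ∀ i, ∃ x, i ∈ I.filter (fun i => ¬ ∀ x ∈ D, ¬ InCluster G U i x) →
        x ∈ D ∧ InCluster G U i x := by
      intro i
      by_cases hi : i ∈ I.filter fun i => ¬ ∀ x ∈ D, ¬ InCluster G U i x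
      · have := (mem_filter.1 hi).2
        push Not at this
        obtain ⟨x, hx⟩ := this
        exact ⟨x, fun _ => hx⟩
      · exact ⟨i, fun h => absurd h hi⟩
    choose g hg using hg
    have h1 : (I.filter fun i => ¬ ∀ x ∈ D, ¬ InCluster G U i x).card ≤
        (D.filter fun x => ¬ x ∈ U).card := by
      refine card_le_card_of_injOn g (fun i hi => ?_)
        (hinj _ g (filter_subset _ _) fun i hi => (hg i hi).2)
      exact mem_filter.2 ⟨(hg i hi).1, (hg i hi).2.1⟩
    have h2 := card_filter_add_card_filter_not (s := I) fun i => ∀ x ∈ D, ¬ InCluster G U i x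
    have h3 := card_filter_add_card_filter_not (s := D) (· ∈ U)
    rw [hS, hL]
    omega
  by_cases hSe : S.Nonempty
  · obtain ⟨s, h1, h2, h3⟩ := h.exists_dominatesClusters (fun u hu => (mem_filter.1 hu).2) hSe
      (fun y hy => hIU y (mem_filter.1 hy).1)
      (fun y hy y' hy' => hIi y (mem_filter.1 hy).1 y' (mem_filter.1 hy').1) hSL
      fun y hy x hx => by
        have hyD := (mem_filter.1 hy).2
        obtain ⟨d, hd, hxd⟩ := hD x fun hxD => hyD x hxD hx
        by_cases hdU : d ∈ U
        · exact ⟨d, mem_filter.2 ⟨hd, hdU⟩, hxd⟩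
        · exact absurd ⟨hdU, h.near_trans (hIU y (mem_filter.1 hy).1) hx.1 hdU hx.2 (Or.inr hxd)⟩
            (hyD d hd)
    exact absurd h3 (hno s h1 h2)
  · have hDU : ∀ d ∈ D, d ∉ U := fun d hd hdU => hSe ⟨d, mem_filter.2 ⟨hd, hdU⟩⟩
    have hg : ∀ i, ∃ x, i ∈ I → x ∈ D ∧ InCluster G U i x := by
      intro i
      by_cases hi : i ∈ I
      · by_cases hiD : i ∈ D
        · exact ⟨i, fun _ => ⟨hiD, hIU i hi, Near.refl i⟩⟩
        · obtain ⟨d, hd, hid⟩ := hD i hiD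
          exact ⟨d, fun _ => ⟨hd, hDU d hd, Or.inr hid⟩⟩
      · exact ⟨i, fun h => absurd h hi⟩
    choose g hg using hg
    have hginj := hinj I g Subset.rfl fun i hi => (hg i hi).2
    -- `D` is disjoint from `U`, meets every cluster and has at most `|I|` vertices: exactly one per
    -- cluster.
    have himg : I.image g = D := by
      refine eq_of_subset_of_card_le (fun x hx => ?_) ?_
      · obtain ⟨i, hi, rfl⟩ := mem_image.1 hx
        exact (hg i hi).1
      · rwa [card_image_of_injOn hginj]
    rintro ⟨x, hx, y, hy, hxy⟩
    rw [← himg] at hx hy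
    obtain ⟨i, hi, rfl⟩ := mem_image.1 hx
    obtain ⟨j, hj, rfl⟩ := mem_image.1 hy
    have hij : i = j := by
      by_contra hne
      exact hIi i hi j hj hne (h.near_center (hIU i hi) (hIU j hj) (hg i hi).2 (hg j hj).2
        (Or.inr hxy))
    exact hxy.ne (by rw [hij])

/-- The size of the induced matchings used in the certificates. -/
def matchingBound (k : ℕ) : ℕ := (k + 1) * (k + 3) + (2 * k + 6) + (k + 1) + (3 * k + 5)

/-- The certificate for a no-instance: a large induced matching such that no `s` vertices with
neighbours in two of its edges dominate `s` clusters. -/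
def HasCertificate (G : SimpleGraph V) (k : ℕ) : Prop :=
  ∃ a b : Fin (matchingBound k) → V, IsInducedMatching G a b ∧
    ∀ s, 1 ≤ s → s ≤ 3 * k + 5 → ¬ DominatesClusters G (touchingTwo G a b) s

/-- By `IsClusterCut.not_hasEdge` it suffices to dominate with one vertex per cluster. Fix `u₁ ∈ U`
and choose representatives adjacent to `u₁` where possible. An undominated vertex `y` lies in `U`
and misses all representatives. In a matching cluster that is good for both `u₁` and `y`, it misses
nothing else, so `u₁` and `y` dominate two such clusters, which the certificate forbids. -/
theorem HasCertificate.not_isYesInstance [Finite V] (hfree : InducedFree (P3kP2 k) G)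
    (hcert : HasCertificate G k) : ¬ IsYesInstance G := by
  classical
  have := Fintype.ofFinite V
  obtain ⟨a, b, hab, hno⟩ := hcert
  have h := hab.isClusterCut hfree (by simp only [matchingBound]; omega)
  have haU := hab.fst_notMem
  have hbU := hab.snd_notMem
  generalize touchingTwo G a b = U at h haU hbU hno
  obtain ⟨I, hIU, hIi, hIc⟩ := exists_representatives G U
  suffices ∃ D, IsDominatingSet G D ∧ D.card ≤ I.card by
    obtain ⟨D, hD, hDc⟩ := this
    rw [isYesInstance_iff]
    rintro ⟨D', hD', hedge, hmin⟩
    exact h.not_hasEdge hno hIU hIi hD' ((hmin D hD).trans hDc) hedge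
  by_cases hUe : ∃ u₁, u₁ ∈ U
  swap
  · refine ⟨I, fun v hv => ?_, le_rfl⟩
    obtain ⟨i, hi, hiv⟩ := hIc v fun hvU => hUe ⟨v, hvU⟩
    exact ⟨i, hi, (hiv.resolve_left fun h => hv (h ▸ hi)).symm⟩
  obtain ⟨u₁, hu₁⟩ := hUe
  have hw : ∀ i, ∃ w, i ∈ I → InCluster G U i w ∧
      ∀ x, InCluster G U i x → G.Adj u₁ x → G.Adj u₁ w := by
    intro i
    by_cases hi : ∃ w, InCluster G U i w ∧ G.Adj u₁ w
    · obtain ⟨w, hw, huw⟩ := hi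
      exact ⟨w, fun _ => ⟨hw, fun _ _ _ => huw⟩⟩
    · push Not at hi
      exact ⟨i, fun hiI => ⟨⟨hIU i hiI, Near.refl i⟩, fun x hx hux => absurd hux (hi x hx)⟩⟩
  choose w hw using hw
  refine ⟨I.image w, fun y hy => ?_, card_image_le⟩
  by_contra! hcon
  have hwI : ∀ i ∈ I, w i ∈ I.image w := fun i hi => mem_image_of_mem _ hi
  have hyU : y ∈ U := by
    by_contra hyU
    obtain ⟨i, hi, hiy⟩ := hIc y hyU
    rcases h.near (hIU i hi) ⟨hyU, hiy⟩ (hw i hi).1 with h' | h'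
    · exact hy (h' ▸ hwI i hi)
    · exact hcon _ (hwI i hi) h'
  -- the clusters of the matching
  choose c hcI hca using fun i => hIc (a i) (haU i)
  have hcinj : Function.Injective c := by
    intro i j hij
    by_contra hne
    rcases h.near_trans (haU i) (hIU _ (hcI i)) (haU j) (hca i).symm (hij ▸ hca j) with h' | h'
    · exact hab.fst_snd j i (Ne.symm hne) (h' ▸ hab.adj i)
    · exact hab.fst_fst i j hne h'
  set C := univ.image c with hC
  have hCI : ∀ i ∈ C, i ∈ I := by
    intro i hi
    obtain ⟨j, -, rfl⟩ := mem_image.1 hi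
    exact hcI j
  have hCc : C.card = matchingBound k := by
    rw [hC, card_image_of_injective _ hcinj, card_univ, Fintype.card_fin]
  have hbad : ∀ u ∈ U, (C.filter (IsBad G U u)).card ≤ k + 1 := fun u hu =>
    h.bad_le u hu _ (fun r hr => hIU r (hCI r (mem_filter.1 hr).1))
      (fun r hr r' hr' hadj => hIi r (hCI r (mem_filter.1 hr).1) r' (hCI r' (mem_filter.1 hr').1)
        hadj.ne (Or.inr hadj))
      fun r hr => (mem_filter.1 hr).2
  have hgood : 1 < (C \ (C.filter (IsBad G U u₁) ∪ C.filter (IsBad G U y))).card := by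
    have h1 := hbad u₁ hu₁
    have h2 := hbad y hyU
    have h3 := card_union_le (C.filter (IsBad G U u₁)) (C.filter (IsBad G U y))
    have h4 := card_le_card_sdiff_add_card (s := C)
      (t := C.filter (IsBad G U u₁) ∪ C.filter (IsBad G U y))
    simp only [matchingBound] at hCc
    omega
  obtain ⟨i, hi, j, hj, hij⟩ := one_lt_card.1 hgood
  have key : ∀ i ∈ C \ (C.filter (IsBad G U u₁) ∪ C.filter (IsBad G U y)),
      ∀ x, InCluster G U i x → G.Adj x u₁ ∨ G.Adj x y := by
    intro i hi x hx
    simp only [mem_sdiff, mem_union, mem_filter, not_or, not_and] at hi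
    obtain ⟨hiC, hb1, hb2⟩ := hi
    obtain ⟨l, -, rfl⟩ := mem_image.1 hiC
    by_contra! hx'
    have hal : InCluster G U (c l) (a l) := ⟨haU l, hca l⟩
    have hbl : InCluster G U (c l) (b l) :=
      ⟨hbU l, h.near_trans (hIU _ (hcI l)) (haU l) (hbU l) (hca l) (Or.inr (hab.adj l))⟩
    -- The cluster contains both `a l` and `b l`, and `u₁` misses at most one vertex of it.
    have hmeet : ∃ z, InCluster G U (c l) z ∧ G.Adj u₁ z := by
      by_contra! hm
      exact hb1 hiC ⟨a l, b l, hal, hbl, (hab.adj l).ne, hm _ hal, hm _ hbl⟩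
    obtain ⟨z, hz, huz⟩ := hmeet
    have huw := (hw _ (hcI l)).2 z hz huz
    refine hb2 hiC ⟨x, w (c l), hx, (hw _ (hcI l)).1, ?_, fun h => hx'.2 h.symm,
      hcon _ (hwI _ (hcI l))⟩
    rintro rfl
    exact hx'.1 huw.symm
  have hiC := hCI i (mem_sdiff.1 hi).1
  have hjC := hCI j (mem_sdiff.1 hj).1
  exact hno 2 (by omega) (by omega) (.pair hu₁ hyU (hIU i hiC) (hIU j hjC) (hIi i hiC j hjC hij)
    (key i hi) (key j hj))

end Certificate

end EdgeContraction

/-! ### Completeness of the certificates and the bounded description of yes-instances -/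

namespace EdgeContraction

open Finset

section Completeness

variable {V : Type*} {G : SimpleGraph V} {k : ℕ} {D : Finset V}

/-- If there is no large induced matching between `D` and its complement, then few vertices of `D`
dominate any given independent set outside `D`. -/
theorem exists_hitting (hD : IsDominatingSet G D) {K : ℕ}
    (hK : ∀ M, IsMatchingFrom G D ∅ M → M.card < K) {W : Finset V} (hWD : ∀ y ∈ W, y ∉ D)
    (hW : ∀ x ∈ W, ∀ y ∈ W, ¬ G.Adj x y) :
    ∃ H : Finset V, H.card ≤ K ∧ ∀ y ∈ W, ∃ d ∈ H, G.Adj y d := by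
  classical
  obtain ⟨H, hH, hmin⟩ := exists_min_image
    (D.powerset.filter fun H => ∀ y ∈ W, ∃ d ∈ H, G.Adj y d) card
    ⟨D, by simpa using fun y hy => hD y (hWD y hy)⟩
  simp only [mem_filter, mem_powerset] at hH hmin
  refine ⟨H, ?_, hH.2⟩
  -- In a smallest `H` each vertex has a private neighbour in `W`; as `W` is independent, these
  -- pairs form a matching from `D`.
  have hpriv : ∀ d, ∃ y, d ∈ H → y ∈ W ∧ G.Adj d y ∧ ∀ d' ∈ H, d' ≠ d → ¬ G.Adj d' y := by
    intro d
    by_cases hd : d ∈ H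
    · by_contra! hcon
      have := hmin (H.erase d) ⟨(erase_subset _ _).trans hH.1, fun y hy => ?_⟩
      · have := card_erase_lt_of_mem hd
        omega
      · obtain ⟨d', hd', hyd'⟩ := hH.2 y hy
        by_cases hdd : d' = d
        · obtain ⟨d'', h1, h2, h3⟩ := (hcon y).2 hy (hdd ▸ hyd'.symm)
          exact ⟨d'', mem_erase.2 ⟨h2, h1⟩, h3.symm⟩
        · exact ⟨d', mem_erase.2 ⟨hdd, hd'⟩, hyd'⟩
    · exact ⟨d, fun h => absurd h hd⟩
  choose p hp using hpriv
  have hM : IsMatchingFrom G D ∅ (H.image fun d => (d, p d)) := by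
    constructor
    · simp only [mem_image]; rintro _ ⟨d, hd, rfl⟩; exact hH.1 hd
    · simp
    · simp only [mem_image]; rintro _ ⟨d, hd, rfl⟩; exact hWD _ (hp d hd).1
    · simp only [mem_image]; rintro _ ⟨d, hd, rfl⟩; exact (hp d hd).2.1
    · simp
    · simp only [mem_image]; rintro _ ⟨d, hd, rfl⟩ _ ⟨d', hd', rfl⟩ hne
      exact (hp d' hd').2.2 d hd fun h => hne (by rw [h])
    · simp only [mem_image]; rintro _ ⟨d, hd, rfl⟩ _ ⟨d', hd', rfl⟩ -
      exact hW _ (hp d hd).1 _ (hp d' hd').1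
  have := hK _ hM
  rw [card_image_of_injective _ fun a b h => (Prod.mk.inj h).1] at this
  exact this.le

/-- If moreover `W` contains no induced matching of size `t`, then few vertices dominate `W \ D`. -/
theorem exists_small_dominating (hD : IsDominatingSet G D) {K t : ℕ}
    (hK : ∀ M, IsMatchingFrom G D ∅ M → M.card < K) (W : Finset V)
    (hW : ∀ a b : Fin t → V, IsInducedMatching G a b → (∀ i, a i ∈ W) → (∀ i, b i ∈ W) → False) :
    ∃ F : Finset V, F.card ≤ 2 * t + K ∧ ∀ y ∈ W, y ∉ D → y ∉ F → ∃ f ∈ F, G.Adj y f := by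
  classical
  let P : ℕ → Prop := fun m => ∃ a b : Fin m → V, IsInducedMatching G a b ∧ (∀ i, a i ∈ W) ∧
    ∀ i, b i ∈ W
  have hP0 : P 0 := ⟨Fin.elim0, Fin.elim0, ⟨fun i => i.elim0, fun i => i.elim0, fun i => i.elim0,
    fun i => i.elim0⟩, fun i => i.elim0, fun i => i.elim0⟩
  obtain ⟨m, hmt, hPm, hPm'⟩ : ∃ m, m < t ∧ P m ∧ ¬ P (m + 1) := by
    by_contra! hcon
    have : ∀ m ≤ t, P m := by
      intro m
      induction m with
      | zero => exact fun _ => hP0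
      | succ m ih => exact fun hm => hcon m hm (ih (by omega))
    obtain ⟨a, b, hab, ha, hb⟩ := this t le_rfl
    exact hW a b hab ha hb
  obtain ⟨a, b, hab, ha, hb⟩ := hPm
  set T := univ.image a ∪ univ.image b with hT
  have hTc : T.card ≤ 2 * m := by
    have h1 := card_union_le (univ.image a) (univ.image b)
    have h2 := card_image_le (s := univ) (f := a)
    have h3 := card_image_le (s := univ) (f := b)
    rw [card_univ, Fintype.card_fin] at h2 h3
    rw [hT]
    omega
  have haT : ∀ i, a i ∈ T := fun i => by simp [hT]
  have hbT : ∀ i, b i ∈ T := fun i => by simp [hT]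
  -- The vertices of `W` without neighbours on a largest induced matching are independent, since an
  -- edge between them would extend it.
  obtain ⟨H, hHc, hH⟩ := exists_hitting hD hK
    (W := W.filter fun y => y ∉ D ∧ ∀ x ∈ T, ¬ G.Adj y x) (fun y hy => (mem_filter.1 hy).2.1) (by
      intro x hx y hy hxy
      simp only [mem_filter] at hx hy
      refine hPm' ⟨Fin.cons x a, Fin.cons y b, ⟨?_, ?_, ?_, ?_⟩, ?_, ?_⟩
      · exact Fin.cases hxy hab.adj
      · refine Fin.cases (Fin.cases (by simp) fun j _ => hx.2.2 _ (haT j)) fun i =>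
          Fin.cases (fun _ h => hx.2.2 _ (haT i) h.symm) fun j hij => ?_
        exact hab.fst_fst i j (by simpa using hij)
      · refine Fin.cases (Fin.cases (by simp) fun j _ => hx.2.2 _ (hbT j)) fun i =>
          Fin.cases (fun _ h => hy.2.2 _ (haT i) h.symm) fun j hij => ?_
        exact hab.fst_snd i j (by simpa using hij)
      · refine Fin.cases (Fin.cases (by simp) fun j _ => hy.2.2 _ (hbT j)) fun i =>
          Fin.cases (fun _ h => hy.2.2 _ (hbT i) h.symm) fun j hij => ?_
        exact hab.snd_snd i j (by simpa using hij)
      · exact Fin.cases hx.1 ha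
      · exact Fin.cases hy.1 hb)
  refine ⟨T ∪ H, ?_, fun y hy hyD hyF => ?_⟩
  · have := card_union_le T H
    omega
  · by_cases hyT : ∀ x ∈ T, ¬ G.Adj y x
    · obtain ⟨d, hd, hyd⟩ := hH y (mem_filter.2 ⟨hy, hyD, hyT⟩)
      exact ⟨d, mem_union_right _ hd, hyd⟩
    · push Not at hyT
      obtain ⟨x, hx, hyx⟩ := hyT
      exact ⟨x, mem_union_left _ hx, hyx⟩

/-- If a minimum dominating set of a no-instance avoids the vertices that meet two edges of a large
induced matching, then the matching is a certificate. -/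
theorem IsInducedMatching.hasCertificate {a b : Fin (matchingBound k) → V}
    (hab : IsInducedMatching G a b) (hfree : InducedFree (P3kP2 k) G) (hD : IsDominatingSet G D)
    (hind : ∀ D', IsDominatingSet G D' → D'.card ≤ D.card → ¬ HasEdge G D')
    (hDU : ∀ d ∈ D, d ∉ touchingTwo G a b) : HasCertificate G k := by
  classical
  refine ⟨a, b, hab, fun s hs1 hs hdc => ?_⟩
  have h := hab.isClusterCut hfree (by simp only [matchingBound]; omega)
  have haU := hab.fst_notMem
  have hbU := hab.snd_notMem
  generalize touchingTwo G a b = U at h haU hbU hdc hDU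
  obtain ⟨u, y, huU, hyU, hyi, hdom⟩ := hdc
  have hDi : ∀ d ∈ D, ∀ d' ∈ D, ¬ G.Adj d d' := fun d hd d' hd' hadj =>
    hind D hD le_rfl ⟨d, hd, d', hd', hadj⟩
  have hrep : ∀ x, x ∉ U → ∃ d ∈ D, Near G x d := by
    intro x hx
    by_cases hxD : x ∈ D
    · exact ⟨x, hxD, Near.refl x⟩
    · obtain ⟨d, hd, hxd⟩ := hD x hxD
      exact ⟨d, hd, Or.inr hxd⟩
  choose c hcD hyc using fun j => hrep (y j) (hyU j)
  choose d hdD had using fun i => hrep (a i) (haU i)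
  have hcinj : Function.Injective c := by
    intro i j hij
    by_contra hne
    exact hyi i j hne (h.near_trans (hyU i) (hDU _ (hcD i)) (hyU j) (hyc i) (hij ▸ (hyc j).symm))
  have hdinj : Function.Injective d := by
    intro i j hij
    by_contra hne
    rcases h.near_trans (haU i) (hDU _ (hdD i)) (haU j) (had i) (hij ▸ (had j).symm) with h' | h'
    · exact hab.fst_snd j i (Ne.symm hne) (h' ▸ hab.adj i)
    · exact hab.fst_fst i j hne h'
  have hCD : univ.image c ⊆ D := fun x hx => by
    obtain ⟨j, -, rfl⟩ := mem_image.1 hx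
    exact hcD j
  have hCc : (univ.image c).card = s := by
    rw [card_image_of_injective _ hcinj, card_univ, Fintype.card_fin]
  have hdc : (univ.image d).card = matchingBound k := by
    rw [card_image_of_injective _ hdinj, card_univ, Fintype.card_fin]
  have hsdiff := card_sdiff_add_card_eq_card hCD
  have hQ := card_le_card_sdiff_add_card (s := univ.image d) (t := univ.image c)
  have hSc : (univ.image u).card ≤ s := by
    have := card_image_le (s := univ) (f := u)
    rwa [card_univ, Fintype.card_fin] at this
  -- `D` has exactly one vertex in each cluster. Those in the `s` dominated clusters are traded for
  -- the `s` vertices `u`; at least `matchingBound k - s` clusters of matching edges remain for `Q`.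
  obtain ⟨D', hD', hedge, hc'⟩ := h.exists_dominating_hasEdge (S := univ.image u)
    (R := D \ univ.image c) (Q := univ.image d \ univ.image c) (u₀ := u ⟨0, hs1⟩) (by simp)
    (huU _) (fun r hr => hDU r (mem_sdiff.1 hr).1)
    (fun r hr r' hr' => hDi r (mem_sdiff.1 hr).1 r' (mem_sdiff.1 hr').1)
    (by
      intro x hx
      obtain ⟨e, he, hxe⟩ := hrep x hx
      by_cases hec : e ∈ univ.image c
      · obtain ⟨j, -, rfl⟩ := mem_image.1 hec
        obtain ⟨i, hi⟩ := hdom j x ⟨hx, h.near_trans (hyU j) (hDU _ (hcD j)) hx (hyc j) hxe.symm⟩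
        exact ⟨u i, by simp, Or.inr hi⟩
      · exact ⟨e, mem_union_right _ (mem_sdiff.2 ⟨he, hec⟩), hxe⟩)
    (by
      intro x hx
      obtain ⟨i, -, rfl⟩ := mem_image.1 (mem_sdiff.1 hx).1
      exact mem_sdiff.2 ⟨hdD i, (mem_sdiff.1 hx).2⟩)
    (by
      intro x hx
      obtain ⟨i, -, rfl⟩ := mem_image.1 (mem_sdiff.1 hx).1
      rcases had i with h' | h'
      · exact ⟨b i, hbU i, h' ▸ hab.adj i⟩
      · exact ⟨a i, haU i, h'.symm⟩)
    (by
      have hmb : matchingBound k =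
        (k + 1) * (k + 3) + (2 * k + 6) + (k + 1) + (3 * k + 5) := rfl
      omega)
  exact hind D' hD' (by omega) hedge

/-- The size from which on minimum dominating sets of no-instances provide certificates. -/
def sizeBound (k : ℕ) : ℕ :=
  2 * (5 * matchingBound k + 2 * k + 5) + (matchingBound k + 1) * matchingBound k + matchingBound k

/-- It suffices to find a large induced matching whose set `U` is disjoint from `D`. One that goes
from `D` to its complement will do, because a vertex of `D` in `U` would allow an exchange creating
an edge. If there is none, any large induced matching will do: its absence, or a vertex of `D` in
`U`, would let few vertices dominate the complement of `D`, and `D` would be small by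
`card_le_of_matching_lt`. -/
theorem hasCertificate_of_lt_card [Fintype V] (hfree : InducedFree (P3kP2 k) G)
    (hdeg : ∀ v, ∃ w, G.Adj v w) (hno : ¬ IsYesInstance G) (hD : IsDominatingSet G D)
    (hmin : ∀ D', IsDominatingSet G D' → D.card ≤ D'.card) (hcard : sizeBound k < D.card) :
    HasCertificate G k := by
  classical
  have hind : ∀ D', IsDominatingSet G D' → D'.card ≤ D.card → ¬ HasEdge G D' := by
    intro D' hD' hc hedge
    exact hno ((isYesInstance_iff G).2 ⟨D', hD', hedge, fun E hE => hc.trans (hmin E hE)⟩)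
  have hDi : ∀ d ∈ D, ∀ d' ∈ D, ¬ G.Adj d d' := fun d hd d' hd' hadj =>
    hind D hD le_rfl ⟨d, hd, d', hd', hadj⟩
  by_cases hK : ∀ M, IsMatchingFrom G D ∅ M → M.card < matchingBound k
  swap
  · push Not at hK
    obtain ⟨M, hM, hMc⟩ := hK
    obtain ⟨e, he, heM⟩ := exists_fin_of_card M hMc
    -- Independence of `D` supplies the condition between near ends that `IsMatchingFrom` lacks.
    have hab : IsInducedMatching G (fun i => (e i).1) fun i => (e i).2 :=
      ⟨fun i => hM.adj _ (heM i), fun i j _ => hDi _ (hM.fst_mem _ (heM i)) _ (hM.fst_mem _ (heM j)),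
        fun i j hij => hM.fst_snd _ (heM i) _ (heM j) (he.ne hij),
        fun i j hij => hM.snd_snd _ (heM i) _ (heM j) (he.ne hij)⟩
    refine hab.hasCertificate hfree hD hind fun u hu huU => ?_
    have h := hab.isClusterCut hfree (by simp only [matchingBound]; omega)
    have haU := hab.fst_notMem
    have hbU := hab.snd_notMem
    generalize touchingTwo G (fun i => (e i).1) (fun i => (e i).2) = U at h haU hbU huU
    have hinj : Function.Injective fun i => (e i).1 := fun i j hij =>
      he (hM.fst_injOn (heM i) (heM j) hij)
    obtain ⟨D', hD', hedge, hc'⟩ := h.exists_dominating_hasEdge (S := D.filter (· ∈ U))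
      (R := D.filter (¬ · ∈ U)) (Q := univ.image fun i => (e i).1) (u₀ := u)
      (mem_filter.2 ⟨hu, huU⟩) huU (fun r hr => (mem_filter.1 hr).2)
      (fun r hr r' hr' => hDi r (mem_filter.1 hr).1 r' (mem_filter.1 hr').1)
      (by
        intro x _
        rw [filter_union_filter_not_eq]
        by_cases hxD : x ∈ D
        · exact ⟨x, hxD, Near.refl x⟩
        · obtain ⟨d, hd, hxd⟩ := hD x hxD
          exact ⟨d, hd, Or.inr hxd⟩)
      (by
        intro x hx
        obtain ⟨i, -, rfl⟩ := mem_image.1 hx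
        exact mem_filter.2 ⟨hM.fst_mem _ (heM i), haU i⟩)
      (by
        intro x hx
        obtain ⟨i, -, rfl⟩ := mem_image.1 hx
        exact ⟨_, hbU i, hab.adj i⟩)
      (by
        rw [card_image_of_injective _ hinj, card_univ, Fintype.card_fin, matchingBound]
        omega)
    rw [card_filter_add_card_filter_not] at hc'
    exact hind D' hD' hc' hedge
  -- With `m = matchingBound k`, the sets used below have size at most `3m` and `3m + 2k + 5`.
  have hsmall : ∀ F₀ : Finset V, (∀ y, y ∉ D → y ∉ F₀ → ∃ f ∈ F₀, G.Adj y f) →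
      F₀.card ≤ 5 * matchingBound k + 2 * k + 5 → False := by
    intro F₀ hF₀ hF₀c
    have := card_le_of_matching_lt hdeg hD hmin hind hK hF₀
    simp only [sizeBound] at hcard
    omega
  by_cases hex : ∃ a b : Fin (matchingBound k) → V, IsInducedMatching G a b
  swap
  · obtain ⟨F, hFc, hF⟩ := exists_small_dominating hD hK univ
      fun a b hab _ _ => hex ⟨a, b, hab⟩
    exact (hsmall F (fun y => hF y (mem_univ y)) (by omega)).elim
  obtain ⟨a, b, hab⟩ := hex
  refine hab.hasCertificate hfree hD hind fun u hu huU => ?_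
  have h := hab.isClusterCut hfree (by simp only [matchingBound]; omega)
  have htouch : ∀ x ∈ touchingTwo G a b, ∃ i, G.Adj x (a i) ∨ G.Adj x (b i) :=
    fun x ⟨i, _, _, hi, _⟩ => ⟨i, hi⟩
  generalize touchingTwo G a b = U at h huU htouch
  -- The edges of an induced matching outside `U` lie in different clusters. If `u` misses both ends
  -- of each, these clusters are bad, so there are at most `k + 1` edges.
  obtain ⟨F, hFc, hF⟩ := exists_small_dominating (t := k + 2) hD hK
    (univ.filter fun x => x ∉ U ∧ ¬ G.Adj u x) (by
      intro x y hxy hx hy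
      simp only [mem_filter, mem_univ, true_and] at hx hy
      have hinj : Function.Injective x := by
        intro i j hij
        by_contra hne
        exact hxy.fst_snd i j hne (hij ▸ hxy.adj j)
      have := h.card_bad_le (ι := Fin (k + 2)) (r := x) (v := x) (w := y) hinj (fun i => (hx i).1)
        (fun i j hadj => hxy.fst_fst i j (fun h => hadj.ne (by rw [h])) hadj)
        (fun i => ⟨(hx i).1, Near.refl _⟩) (fun i => ⟨(hy i).1, Or.inr (hxy.adj i)⟩)
        (fun i => (hxy.adj i).ne) huU univ (fun i _ => (hx i).2) (fun i _ => (hy i).2)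
      rw [card_univ, Fintype.card_fin] at this
      omega)
  refine hsmall (insert u (F ∪ (univ.image a ∪ univ.image b))) (fun y hyD hy => ?_) ?_
  · simp only [mem_insert, mem_union, not_or] at hy
    by_cases hyU : y ∈ U
    · obtain ⟨i, hi | hi⟩ := htouch y hyU
      · exact ⟨a i, by simp, hi⟩
      · exact ⟨b i, by simp, hi⟩
    by_cases hyu : G.Adj u y
    · exact ⟨u, by simp, hyu.symm⟩
    · obtain ⟨f, hf, hyf⟩ := hF y (by simp [hyU, hyu]) hyD hy.2.1
      exact ⟨f, by simp [hf], hyf⟩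
  · have h1 := card_insert_le u (F ∪ (univ.image a ∪ univ.image b))
    have h2 := card_union_le F (univ.image a ∪ univ.image b)
    have h3 := card_union_le (univ.image a) (univ.image b)
    have h4 := card_image_le (s := univ) (f := a)
    have h5 := card_image_le (s := univ) (f := b)
    rw [card_univ, Fintype.card_fin] at h4 h5
    omega

/-- Every vertex is equal or adjacent to one of `f`. -/
def Dominates {t : ℕ} (G : SimpleGraph V) (f : Fin t → V) : Prop := ∀ v, ∃ i, Near G v (f i)

theorem Dominates.exists_finset {t : ℕ} {f : Fin t → V} (hf : Dominates G f) :
    ∃ D, IsDominatingSet G D ∧ D.card ≤ t ∧ ∀ x, x ∈ D ↔ ∃ i, f i = x := by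
  classical
  refine ⟨univ.image f, fun v hv => ?_, ?_, fun x => by simp⟩
  · obtain ⟨i, hi⟩ := hf v
    exact ⟨f i, by simp, hi.resolve_left fun h => hv (by simp [h])⟩
  · have := card_image_le (s := univ) (f := f)
    rwa [card_univ, Fintype.card_fin] at this

theorem IsDominatingSet.exists_dominates [Nonempty V] (hD : IsDominatingSet G D) {t : ℕ}
    (ht : D.card ≤ t) : ∃ f : Fin t → V, Dominates G f ∧ ∀ d ∈ D, ∃ i, f i = d := by
  classical
  have hf : ∀ d ∈ D, ∃ i : Fin t, (if h : i.1 < D.card then (D.equivFin.symm ⟨i, h⟩).1 else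
      Classical.arbitrary V) = d := by
    intro d hd
    have hlt := (D.equivFin ⟨d, hd⟩).2
    exact ⟨⟨_, hlt.trans_le ht⟩, by simp⟩
  refine ⟨fun i => if h : i.1 < D.card then (D.equivFin.symm ⟨i, h⟩).1 else
    Classical.arbitrary V, fun v => ?_, hf⟩
  by_cases hv : v ∈ D
  · obtain ⟨i, hi⟩ := hf v hv
    exact ⟨i, Or.inl hi.symm⟩
  · obtain ⟨d, hd, hvd⟩ := hD v hv
    obtain ⟨i, hi⟩ := hf d hd
    refine ⟨i, Or.inr ?_⟩
    simp only
    rwa [hi]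

/-- The yes-instances, described with a bounded number of quantifiers over vertices. -/
theorem isYesInstance_iff_bounded [Finite V] (hconn : G.Connected)
    (hfree : InducedFree (P3kP2 k) G) :
    IsYesInstance G ↔
      (∃ t : Fin (sizeBound k), (∃ f : Fin (t.1 + 1) → V, Dominates G f ∧ ∃ i j, G.Adj (f i) (f j)) ∧
        ¬ ∃ f : Fin t.1 → V, Dominates G f) ∨
      (¬ ∃ f : Fin (sizeBound k) → V, Dominates G f) ∧ ¬ HasCertificate G k := by
  classical
  have := Fintype.ofFinite V
  have := hconn.nonempty
  constructor
  · intro hyes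
    obtain ⟨D, hD, ⟨u, hu, v, hv, huv⟩, hmin⟩ := (isYesInstance_iff G).1 hyes
    by_cases hc : D.card ≤ sizeBound k
    · have hpos : 0 < D.card := card_pos.2 ⟨u, hu⟩
      refine Or.inl ⟨⟨D.card - 1, by omega⟩, ?_, ?_⟩
      · obtain ⟨f, hf, hfD⟩ := hD.exists_dominates (t := D.card - 1 + 1) (by omega)
        obtain ⟨i, rfl⟩ := hfD u hu
        obtain ⟨j, rfl⟩ := hfD v hv
        exact ⟨f, hf, i, j, huv⟩
      · rintro ⟨f, hf⟩
        obtain ⟨D', hD', hc', -⟩ := hf.exists_finset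
        have := hmin D' hD'
        simp only at hc'
        omega
    · refine Or.inr ⟨?_, fun h => h.not_isYesInstance hfree hyes⟩
      rintro ⟨f, hf⟩
      obtain ⟨D', hD', hc', -⟩ := hf.exists_finset
      have := hmin D' hD'
      omega
  · rintro (⟨t, ⟨f, hf, i, j, hij⟩, hno⟩ | ⟨hno, hcert⟩)
    · obtain ⟨D, hD, hc, hmem⟩ := hf.exists_finset
      refine (isYesInstance_iff G).2 ⟨D, hD, ⟨f i, (hmem _).2 ⟨i, rfl⟩, f j, (hmem _).2 ⟨j, rfl⟩,
        hij⟩, fun D' hD' => ?_⟩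
      by_contra! hlt
      obtain ⟨g, hg, -⟩ := hD'.exists_dominates (t := t.1) (by omega)
      exact hno ⟨g, hg⟩
    · by_contra hyes
      obtain ⟨D, hD, hDc⟩ := exists_card_eq_dominationNumber G
      have hcard : sizeBound k < D.card := by
        by_contra! hle
        obtain ⟨g, hg, -⟩ := hD.exists_dominates hle
        exact hno ⟨g, hg⟩
      refine hcert (hasCertificate_of_lt_card hfree (fun v => ?_) hyes hD
        (fun D' hD' => hDc ▸ dominationNumber_le hD') hcard)
      -- More than one vertex rules out isolated vertices in a connected graph.
      have : Nontrivial V := by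
        have h1 := card_le_univ D
        have h2 : 1 ≤ sizeBound k := by simp only [sizeBound]; omega
        exact Fintype.one_lt_card_iff_nontrivial.1 (by omega)
      exact hconn.preconnected.exists_adj_of_nontrivial v

end Completeness

end EdgeContraction

/-! ### First-order definability of the yes-instances -/

namespace EdgeContraction

open FirstOrder
open Sum (inl inr)

section FirstOrderProperties

/-- A property of graphs with vertices named by `α` that a first-order formula expresses. -/
def IsFirstOrder {α : Type} (R : ∀ n, SimpleGraph (Fin n) → (α → Fin n) → Prop) : Prop :=
  ∃ φ : Language.graph.Formula α, ∀ n (G : SimpleGraph (Fin n)) (x : α → Fin n),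
    @Language.Formula.Realize _ _ G.structure _ φ x ↔ R n G x

namespace IsFirstOrder

variable {α β : Type} {R S : ∀ n, SimpleGraph (Fin n) → (α → Fin n) → Prop}

theorem congr (h : IsFirstOrder R) (hRS : ∀ n G x, R n G x ↔ S n G x) : IsFirstOrder S :=
  h.imp fun _ hφ n G x => (hφ n G x).trans (hRS n G x)

/-- Serves for side conditions such as `i ≠ j` on indices, which do not depend on the graph. -/
theorem const (p : Prop) : IsFirstOrder (α := α) fun _ _ _ => p := by
  by_cases hp : p
  · exact ⟨⊤, fun n G x => by
      let := G.structure
      simp [hp]⟩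
  · exact ⟨⊥, fun n G x => by
      let := G.structure
      simp [hp]⟩

theorem adj (i j : α) : IsFirstOrder fun _ G (x : α → _) => G.Adj (x i) (x j) :=
  ⟨Language.Relations.formula₂ Language.adj (.var i) (.var j), fun n G x => by
    let := G.structure
    rw [Language.Formula.realize_rel₂]
    exact Iff.rfl⟩

theorem eq (i j : α) : IsFirstOrder fun _ _ (x : α → _) => x i = x j :=
  ⟨Language.Term.equal (.var i) (.var j), fun n G x => by
    let := G.structure
    rw [Language.Formula.realize_equal]
    exact Iff.rfl⟩

theorem not (h : IsFirstOrder R) : IsFirstOrder fun n G x => ¬ R n G x := by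
  obtain ⟨φ, hφ⟩ := h
  exact ⟨∼φ, fun n G x => by
    let := G.structure
    rw [Language.Formula.realize_not, hφ]⟩

theorem and (h : IsFirstOrder R) (h' : IsFirstOrder S) :
    IsFirstOrder fun n G x => R n G x ∧ S n G x := by
  obtain ⟨φ, hφ⟩ := h
  obtain ⟨ψ, hψ⟩ := h'
  exact ⟨φ ⊓ ψ, fun n G x => by
    let := G.structure
    rw [Language.Formula.realize_inf, hφ, hψ]⟩

theorem or (h : IsFirstOrder R) (h' : IsFirstOrder S) :
    IsFirstOrder fun n G x => R n G x ∨ S n G x :=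
  (h.not.and h'.not).not.congr fun n G x => by tauto

theorem imp (h : IsFirstOrder R) (h' : IsFirstOrder S) :
    IsFirstOrder fun n G x => R n G x → S n G x :=
  (h.not.or h').congr fun n G x => by tauto

theorem exists_index {ι : Type} [Finite ι] {R : ι → ∀ n, SimpleGraph (Fin n) → (α → Fin n) → Prop}
    (h : ∀ i, IsFirstOrder (R i)) : IsFirstOrder fun n G x => ∃ i, R i n G x := by
  choose φ hφ using h
  exact ⟨Language.Formula.iSup φ, fun n G x => by
    let := G.structure
    rw [Language.Formula.realize_iSup]
    exact exists_congr fun i => hφ i n G x⟩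

theorem forall_index {ι : Type} [Finite ι] {R : ι → ∀ n, SimpleGraph (Fin n) → (α → Fin n) → Prop}
    (h : ∀ i, IsFirstOrder (R i)) : IsFirstOrder fun n G x => ∀ i, R i n G x :=
  (exists_index fun i => (h i).not).not.congr fun n G x => by simp

theorem exists_tuple [Finite β]
    {R : ∀ n, SimpleGraph (Fin n) → (α → Fin n) → (β → Fin n) → Prop}
    (h : IsFirstOrder fun n G (z : α ⊕ β → Fin n) => R n G (fun a => z (inl a)) fun b => z (inr b)) :
    IsFirstOrder fun n G x => ∃ y : β → Fin n, R n G x y := by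
  obtain ⟨φ, hφ⟩ := h
  refine ⟨φ.iExs, fun n G x => ?_⟩
  let := G.structure
  rw [Language.Formula.realize_iExs]
  exact exists_congr fun y => by rw [hφ]; rfl

theorem forall_vertex {R : ∀ n, SimpleGraph (Fin n) → (α → Fin n) → Fin n → Prop}
    (h : IsFirstOrder fun n G (z : α ⊕ Unit → Fin n) => R n G (fun a => z (inl a)) (z (inr ()))) :
    IsFirstOrder fun n G x => ∀ v, R n G x v :=
  (exists_tuple (R := fun n G x y => ¬ R n G x (y ())) h.not).not.congr fun n G x => by
    simp only [not_exists, not_not]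
    exact ⟨fun h v => h fun _ => v, fun h y => h (y ())⟩

theorem near (i j : α) : IsFirstOrder fun _ G (x : α → _) => Near G (x i) (x j) :=
  (eq i j).or (adj i j)

theorem mem_touchingTwo {ι : Type} [Finite ι] (i : α) (a b : ι → α) :
    IsFirstOrder fun _ G (x : α → _) => x i ∈ touchingTwo G (fun j => x (a j)) fun j => x (b j) :=
  exists_index fun j => exists_index fun l => (const (j ≠ l)).and
    (((adj i (a j)).or (adj i (b j))).and ((adj i (a l)).or (adj i (b l))))

theorem isInducedMatching {ι : Type} [Finite ι] (a b : ι → α) :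
    IsFirstOrder fun _ G (x : α → _) =>
      IsInducedMatching G (fun j => x (a j)) fun j => x (b j) :=
  ((forall_index fun i => adj (a i) (b i)).and
    ((forall_index fun i => forall_index fun j => (const (i ≠ j)).imp (adj (a i) (a j)).not).and
    ((forall_index fun i => forall_index fun j => (const (i ≠ j)).imp (adj (a i) (b j)).not).and
    (forall_index fun i => forall_index fun j => (const (i ≠ j)).imp (adj (b i) (b j)).not)))).congr
    fun _ _ _ => ⟨fun h => ⟨h.1, h.2.1, h.2.2.1, h.2.2.2⟩,
      fun h => ⟨h.adj, h.fst_fst, h.fst_snd, h.snd_snd⟩⟩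

theorem dominatesClusters {ι : Type} [Finite ι] (a b : ι → α) (s : ℕ) :
    IsFirstOrder fun _ G (x : α → _) =>
      DominatesClusters G (touchingTwo G (fun j => x (a j)) fun j => x (b j)) s :=
  exists_tuple <| exists_tuple <|
    (forall_index fun i => mem_touchingTwo (inl (inr i)) (fun j => inl (inl (a j)))
      fun j => inl (inl (b j))).and <|
    (forall_index fun i => (mem_touchingTwo (inr i) (fun j => inl (inl (a j)))
      fun j => inl (inl (b j))).not).and <|
    (forall_index fun i => forall_index fun j => (const (i ≠ j)).imp
      (near (inr i) (inr j)).not).and <|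
    forall_index fun j => forall_vertex <|
      ((mem_touchingTwo (inr ()) (fun j => inl (inl (inl (a j))))
        fun j => inl (inl (inl (b j)))).not.and (near (inl (inr j)) (inr ()))).imp <|
      exists_index fun i => adj (inr ()) (inl (inl (inr i)))

theorem hasCertificate (k : ℕ) :
    IsFirstOrder (α := α) fun _ G _ => HasCertificate G k :=
  exists_tuple <| exists_tuple <| (isInducedMatching (fun i => inl (inr i)) fun i => inr i).and <|
    (forall_index (ι := Fin (3 * k + 6)) fun s => (const (1 ≤ s.1)).imp <|
      (dominatesClusters (fun i => inl (inr i)) (fun i => inr i) s.1).not).congr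
      fun _ _ _ => ⟨fun h s h1 h2 => h ⟨s, by omega⟩ h1, fun h s h1 => h s.1 h1 (by omega)⟩

theorem dominates {t : ℕ} (f : Fin t → α) :
    IsFirstOrder fun _ G (x : α → _) => Dominates G fun i => x (f i) :=
  forall_vertex <| exists_index fun i => near (inr ()) (inl (f i))

/-- On connected `(P₃ + k P₂)`-free graphs the yes-instances are first-order definable. -/
theorem isYesInstance (k : ℕ) : ∃ φ : Language.graph.Sentence, ∀ n (G : SimpleGraph (Fin n)),
    G.Connected → InducedFree (P3kP2 k) G →
      (@Language.Sentence.Realize _ _ G.structure φ ↔ IsYesInstance G) := by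
  obtain ⟨φ, hφ⟩ : IsFirstOrder (α := Empty) fun n G _ =>
      (∃ t : Fin (sizeBound k), (∃ f : Fin (t.1 + 1) → Fin n, Dominates G f ∧
        ∃ i j, G.Adj (f i) (f j)) ∧ ¬ ∃ f : Fin t.1 → Fin n, Dominates G f) ∨
      (¬ ∃ f : Fin (sizeBound k) → Fin n, Dominates G f) ∧ ¬ HasCertificate G k :=
    (exists_index fun t => (exists_tuple <| (dominates fun i => inr i).and <|
      exists_index fun i => exists_index fun j => adj (inr i) (inr j)).and
      (exists_tuple <| dominates fun i => inr i).not).or <|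
    (exists_tuple <| dominates fun i => inr i).not.and (hasCertificate k).not
  exact ⟨φ, fun n G hc hf => (hφ n G default).trans (isYesInstance_iff_bounded hc hf).symm⟩

end IsFirstOrder

end FirstOrderProperties

end EdgeContraction

namespace EdgeContraction

/-! ### Machines that sweep over a list with a finite transducer -/

namespace Sweep

section

variable {C Q : Type}

/-- The run of a transducer over a list. -/
def scan (δ : Q → C → Q × C) : Q → List C → Q × List C
  | q, [] => (q, [])
  | q, c :: l => ((scan δ (δ q c).1 l).1, (δ q c).2 :: (scan δ (δ q c).1 l).2)

theorem length_scan (δ : Q → C → Q × C) (q : Q) (l : List C) : (scan δ q l).2.length = l.length := by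
  induction l generalizing q with
  | nil => rfl
  | cons c l ih => simp [scan, ih]

theorem scan_append (δ : Q → C → Q × C) (q : Q) (l l' : List C) :
    scan δ q (l ++ l') = ((scan δ (scan δ q l).1 l').1,
      (scan δ q l).2 ++ (scan δ (scan δ q l).1 l').2) := by
  induction l generalizing q with
  | nil => rfl
  | cons c l ih => simp [scan, ih]

/-- Sweeping at most `n` times over the list with the transducer `δ`, where `ε` says after each sweep
whether to go on, leads to the answer `b`. -/
def HaltsIn (δ : Q → C → Q × C) (ε : Q → Q ⊕ Bool) : ℕ → Q → List C → Bool → Prop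
  | 0, _, _, _ => False
  | n + 1, q, l, b => ε (scan δ q l).1 = .inr b ∨
      ∃ q', ε (scan δ q l).1 = .inl q' ∧ HaltsIn δ ε n q' (scan δ q l).2 b

theorem HaltsIn.mono {δ : Q → C → Q × C} {ε : Q → Q ⊕ Bool} {m n : ℕ} (hmn : m ≤ n) {q : Q}
    {l : List C} {b : Bool} (h : HaltsIn δ ε m q l b) : HaltsIn δ ε n q l b := by
  induction m generalizing n q l with
  | zero => exact h.elim
  | succ m ih =>
    obtain ⟨n, rfl⟩ : ∃ k, n = k + 1 := ⟨n - 1, by omega⟩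
    exact h.imp id fun ⟨q', h1, h2⟩ => ⟨q', h1, ih (by omega) h2⟩

/-- The three stacks: input and output, the part of the list ahead, the part behind. -/
inductive Stack
  | io
  | ahead
  | behind
  deriving DecidableEq

instance : Fintype Stack := ⟨{.io, .ahead, .behind}, fun k => by cases k <;> simp⟩

/-- The phases of the machine. -/
inductive Phase
  | read
  | rewind
  | sweep
  | clean (b : Bool)
  deriving DecidableEq

instance : Fintype Phase :=
  ⟨{.read, .rewind, .sweep, .clean true, .clean false}, fun k => by
    cases k with
    | clean b => cases b <;> simp
    | _ => simp⟩

/-- The symbols on the stacks. -/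
abbrev Symbol (C : Type) : Stack → Type
  | .io => Bool
  | .ahead => C
  | .behind => C

open Turing.TM2.Stmt in
/-- The program of the sweeping machine. -/
def program (ι : Bool → C) (δ : Q → C → Q × C) (ε : Q → Q ⊕ Bool) (q₀ : Q) :
    Phase → Turing.TM2.Stmt (Symbol C) Phase (Q × Option C)
  | .read => pop .io (fun s o => (s.1, o.map ι)) <|
      branch (fun s => s.2.isSome)
        (push .behind (fun s => s.2.getD (ι true)) <| load (fun s => (s.1, none)) <|
          goto fun _ => .read)
        (goto fun _ => .rewind)
  | .rewind => pop .behind (fun s o => (s.1, o)) <|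
      branch (fun s => s.2.isSome)
        (push .ahead (fun s => s.2.getD (ι true)) <| load (fun s => (s.1, none)) <|
          goto fun _ => .rewind)
        (goto fun _ => .sweep)
  | .sweep => pop .ahead (fun s o => (s.1, o)) <|
      branch (fun s => s.2.isSome)
        (push .behind (fun s => (δ s.1 (s.2.getD (ι true))).2) <|
          load (fun s => ((δ s.1 (s.2.getD (ι true))).1, none)) <| goto fun _ => .sweep)
        (branch (fun s => (ε s.1).isLeft)
          (load (fun s => ((ε s.1).elim id fun _ => q₀, none)) <| goto fun _ => .rewind)
          (goto fun s => .clean ((ε s.1).elim (fun _ => false) id)))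
  | .clean b => pop .behind (fun s o => (s.1, o)) <|
      branch (fun s => s.2.isSome)
        (load (fun s => (s.1, none)) <| goto fun _ => .clean b)
        (push .io (fun _ => b) <| load (fun _ => (q₀, none)) halt)

/-- The contents of the stacks. -/
def contents (i : List Bool) (a b : List C) : ∀ k, List (Symbol C k)
  | .io => i
  | .ahead => a
  | .behind => b

@[simp] theorem contents_io (i : List Bool) (a b : List C) : contents i a b .io = i := rfl
@[simp] theorem contents_ahead (i : List Bool) (a b : List C) : contents i a b .ahead = a := rfl
@[simp] theorem contents_behind (i : List Bool) (a b : List C) : contents i a b .behind = b := rfl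

@[simp] theorem update_io (i i' : List Bool) (a b : List C) :
    Function.update (contents i a b) .io i' = contents i' a b := by
  funext k; cases k <;> rfl

@[simp] theorem update_ahead (i : List Bool) (a a' b : List C) :
    Function.update (contents i a b) .ahead a' = contents i a' b := by
  funext k; cases k <;> rfl

@[simp] theorem update_behind (i : List Bool) (a b b' : List C) :
    Function.update (contents i a b) .behind b' = contents i a b' := by
  funext k; cases k <;> rfl

/-- A configuration of the sweeping machine. -/
def cfg (p : Option Phase) (q : Q) (i : List Bool) (a b : List C) :
    Turing.TM2.Cfg (Symbol C) Phase (Q × Option C) :=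
  ⟨p, (q, none), contents i a b⟩

variable (ι : Bool → C) (δ : Q → C → Q × C) (ε : Q → Q ⊕ Bool) (q₀ : Q)

/-- The machine gets from one configuration to the other in `n` steps. -/
def Reaches (n : ℕ) (c c' : Turing.TM2.Cfg (Symbol C) Phase (Q × Option C)) : Prop :=
  (flip bind (Turing.TM2.step (program ι δ ε q₀)))^[n] (some c) = some c'

variable {ι δ ε q₀}

theorem Reaches.trans {m n : ℕ} {c c' c'' : Turing.TM2.Cfg (Symbol C) Phase (Q × Option C)}
    (h : Reaches ι δ ε q₀ m c c') (h' : Reaches ι δ ε q₀ n c' c'') :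
    Reaches ι δ ε q₀ (m + n) c c'' := by
  rw [Reaches, Nat.add_comm, Function.iterate_add_apply, h]
  exact h'

theorem Reaches.step {c c' : Turing.TM2.Cfg (Symbol C) Phase (Q × Option C)}
    (h : Turing.TM2.step (program ι δ ε q₀) c = some c') : Reaches ι δ ε q₀ 1 c c' := h

theorem reaches_read (q : Q) (i : List Bool) (b : List C) :
    Reaches ι δ ε q₀ (i.length + 1) (cfg (some .read) q i [] b)
      (cfg (some .rewind) q [] [] ((i.map ι).reverse ++ b)) := by
  induction i generalizing b with
  | nil => exact .step (by simp [cfg, Turing.TM2.step, program, Turing.TM2.stepAux])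
  | cons x i ih =>
    have h : Reaches ι δ ε q₀ 1 (cfg (some .read) q (x :: i) [] b)
        (cfg (some .read) q i [] (ι x :: b)) :=
      .step (by simp [cfg, Turing.TM2.step, program, Turing.TM2.stepAux])
    have := h.trans (ih (ι x :: b))
    rw [Nat.add_comm] at this
    simpa using this

theorem reaches_rewind (q : Q) (a b : List C) :
    Reaches ι δ ε q₀ (b.length + 1) (cfg (some .rewind) q [] a b)
      (cfg (some .sweep) q [] (b.reverse ++ a) []) := by
  induction b generalizing a with
  | nil => exact .step (by simp [cfg, Turing.TM2.step, program, Turing.TM2.stepAux])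
  | cons x b ih =>
    have h : Reaches ι δ ε q₀ 1 (cfg (some .rewind) q [] a (x :: b))
        (cfg (some .rewind) q [] (x :: a) b) :=
      .step (by simp [cfg, Turing.TM2.step, program, Turing.TM2.stepAux])
    have := h.trans (ih (x :: a))
    rw [Nat.add_comm] at this
    simpa using this

theorem reaches_sweep (q : Q) (a b : List C) :
    Reaches ι δ ε q₀ a.length (cfg (some .sweep) q [] a b)
      (cfg (some .sweep) (scan δ q a).1 [] [] ((scan δ q a).2.reverse ++ b)) := by
  induction a generalizing q b with
  | nil => rfl
  | cons x a ih =>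
    have h : Reaches ι δ ε q₀ 1 (cfg (some .sweep) q [] (x :: a) b)
        (cfg (some .sweep) (δ q x).1 [] a ((δ q x).2 :: b)) :=
      .step (by simp [cfg, Turing.TM2.step, program, Turing.TM2.stepAux])
    have := h.trans (ih (δ q x).1 ((δ q x).2 :: b))
    rw [Nat.add_comm] at this
    simpa [scan] using this

/-- The halting configuration prescribes empty work stacks and the initial register, hence a
cleaning phase. -/
theorem reaches_clean (q : Q) (b : List C) (x : Bool) :
    Reaches ι δ ε q₀ (b.length + 1) (cfg (some (.clean x)) q [] [] b) (cfg none q₀ [x] [] []) := by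
  induction b with
  | nil => exact .step (by simp [cfg, Turing.TM2.step, program, Turing.TM2.stepAux])
  | cons y b ih =>
    have h : Reaches ι δ ε q₀ 1 (cfg (some (.clean x)) q [] [] (y :: b))
        (cfg (some (.clean x)) q [] [] b) :=
      .step (by simp [cfg, Turing.TM2.step, program, Turing.TM2.stepAux])
    have := h.trans ih
    rw [Nat.add_comm] at this
    simpa using this

/-- For a list of length `ℓ`, rewinding, sweeping and the decision take `2ℓ + 2` steps per round;
the extra round in the bound pays for the cleaning. -/
theorem HaltsIn.reaches {n : ℕ} {q : Q} {l : List C} {b : Bool} (h : HaltsIn δ ε n q l b) :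
    ∃ m ≤ (n + 1) * (2 * l.length + 2),
      Reaches ι δ ε q₀ m (cfg (some .rewind) q [] [] l.reverse) (cfg none q₀ [b] [] []) := by
  induction n generalizing q l with
  | zero => exact h.elim
  | succ n ih =>
    have h1 := (reaches_rewind (ι := ι) (δ := δ) (ε := ε) (q₀ := q₀) q [] l.reverse).trans
      (reaches_sweep q _ [])
    simp only [List.length_reverse, List.reverse_reverse, List.append_nil] at h1
    rcases h with h | ⟨q', hq', h⟩
    · have h2 : Reaches ι δ ε q₀ 1 (cfg (some .sweep) (scan δ q l).1 [] [] (scan δ q l).2.reverse)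
          (cfg (some (.clean b)) (scan δ q l).1 [] [] (scan δ q l).2.reverse) :=
        .step (by simp [cfg, Turing.TM2.step, program, Turing.TM2.stepAux, h])
      refine ⟨_, ?_, (h1.trans h2).trans (reaches_clean _ _ b)⟩
      rw [List.length_reverse, length_scan]
      have : (n + 1 + 1) * (2 * l.length + 2) = n * (2 * l.length + 2) + 2 * (2 * l.length + 2) := by
        ring
      omega
    · have h2 : Reaches ι δ ε q₀ 1 (cfg (some .sweep) (scan δ q l).1 [] [] (scan δ q l).2.reverse)
          (cfg (some .rewind) q' [] [] (scan δ q l).2.reverse) :=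
        .step (by simp [cfg, Turing.TM2.step, program, Turing.TM2.stepAux, hq'])
      obtain ⟨m, hm, h3⟩ := ih h
      refine ⟨_, ?_, (h1.trans h2).trans h3⟩
      rw [length_scan] at hm
      have : (n + 1 + 1) * (2 * l.length + 2) = (n + 1) * (2 * l.length + 2) + (2 * l.length + 2) := by
        ring
      omega

variable (ι δ ε q₀) in
/-- The sweeping machine. -/
def machine [Fintype C] [Fintype Q] : Turing.FinTM2 where
  K := Stack
  k₀ := .io
  k₁ := .io
  Γ := Symbol C
  Λ := Phase
  main := .read
  σ := Q × Option C
  initialState := (q₀, none)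
  Γk₀Fin := inferInstanceAs (Fintype Bool)
  m := program ι δ ε q₀

theorem initList_machine [Fintype C] [Fintype Q] (i : List Bool) :
    Turing.initList (machine ι δ ε q₀) i = cfg (some .read) q₀ i [] [] :=
  congrArg (Turing.TM2.Cfg.mk (some Phase.read) (q₀, none)) (funext fun k => by cases k <;> rfl)

theorem haltList_machine [Fintype C] [Fintype Q] (i : List Bool) :
    Turing.haltList (machine ι δ ε q₀) i = cfg none q₀ i [] [] :=
  congrArg (Turing.TM2.Cfg.mk none (q₀, none)) (funext fun k => by cases k <;> rfl)

/-- A function that is computed by polynomially many sweeps of a finite transducer can be computed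
in polynomial time. -/
theorem polyTime [Fintype C] [Fintype Q] (ι : Bool → C) (δ : Q → C → Q × C) (ε : Q → Q ⊕ Bool)
    (q₀ : Q) {α : Type} (ea : α → List Bool) (f : α → Bool) (P : Polynomial ℕ)
    (h : ∀ a, HaltsIn δ ε (P.eval (ea a).length) q₀ ((ea a).map ι) (f a)) :
    Nonempty (Turing.TM2ComputableInPolyTime ea Computability.encodeBool f) := by
  refine ⟨{
    tm := machine ι δ ε q₀
    inputAlphabet := Equiv.refl _
    outputAlphabet := Equiv.refl _
    time := (Polynomial.X + 1) + (P + 1) * (2 * Polynomial.X + 2)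
    outputsFun := fun a => Classical.choice ?_ }⟩
  obtain ⟨m, hm, h1⟩ := (h a).reaches (ι := ι) (q₀ := q₀)
  have h2 := (reaches_read (ι := ι) (δ := δ) (ε := ε) (q₀ := q₀) q₀ (ea a) []).trans
    (by rwa [List.append_nil])
  refine ⟨⟨⟨(ea a).length + 1 + m, ?_⟩, ?_⟩⟩
  · have e : List.map (Equiv.refl Bool).invFun (ea a) = ea a := List.map_id _
    refine Eq.trans ?_ (Eq.trans h2 (congrArg some (haltList_machine [f a]).symm))
    exact congrArg _ (congrArg some ((congrArg _ e).trans (initList_machine _)))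
  · simp only [List.length_map] at hm
    simp only [Polynomial.eval_add, Polynomial.eval_mul, Polynomial.eval_X, Polynomial.eval_one,
      Polynomial.eval_ofNat]
    omega

end

end Sweep

end EdgeContraction

namespace EdgeContraction

/-! ### Collecting the types of tuples with an odometer -/

namespace Odometer

section

variable {O : Type}

/-- Types of rank `d` over the observations `O`. -/
def Ty (O : Type) : ℕ → Type
  | 0 => O
  | d + 1 => Set (Ty O d)

/-- The memory needed to collect a type of rank `d`. -/
def Memory (O : Type) : ℕ → Type
  | 0 => Unit
  | d + 1 => Memory O d × Set (Ty O d)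

/-- The empty memory. -/
def Memory.empty : ∀ d, Memory O d
  | 0 => ()
  | d + 1 => (empty d, ∅)

instance finite_ty [Finite O] : ∀ d, Finite (Ty O d)
  | 0 => ‹Finite O›
  | d + 1 => have := finite_ty d; inferInstanceAs (Finite (Set (Ty O d)))

instance finite_memory [Finite O] : ∀ d, Finite (Memory O d)
  | 0 => inferInstanceAs (Finite Unit)
  | d + 1 => have := finite_memory d; inferInstanceAs (Finite (Memory O d × Set (Ty O d)))

/-- The type of rank `d` of the tuple `x`: digits below `d` are quantified. -/
def tp (n : ℕ) (obs : (ℕ → ℕ) → O) : ∀ d, (ℕ → ℕ) → Ty O d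
  | 0, x => obs x
  | d + 1, x => {t : Ty O d | ∃ v < n, tp n obs d (Function.update x d v) = t}

/-- Process one observation; `mx` tells which digits are maximal. -/
def collect (mx : ℕ → Bool) (o : O) : ∀ d, Memory O d → Memory O d × Option (Ty O d)
  | 0, s => (s, some o)
  | d + 1, s =>
    match collect mx o d s.1 with
    | (s', none) => ((s', s.2), none)
    | (s', some t) =>
      if mx d then ((s', ∅), some (insert t s.2 : Set (Ty O d))) else ((s', insert t s.2), none)

/-- The successor of a tuple. -/
def succ (n : ℕ) (x : ℕ → ℕ) (e : ℕ) : ℕ :=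
  if ∀ j < e, x j + 1 = n then if x e + 1 = n then 0 else x e + 1 else x e

theorem succ_lt {n : ℕ} {x : ℕ → ℕ} (hx : ∀ j, x j < n) (j : ℕ) : succ n x j < n := by
  have := hx j
  unfold succ
  split_ifs <;> omega

/-- Counting from `x` with memory `s`, the first output is `t` and comes with the `m`-th observation,
which is at `x'`. -/
inductive Yields (n : ℕ) (mx : (ℕ → ℕ) → ℕ → Bool) (obs : (ℕ → ℕ) → O) (d : ℕ) :
    ℕ → (ℕ → ℕ) → Memory O d → Ty O d → (ℕ → ℕ) → Prop
  | output {x s t} (h : collect (mx x) (obs x) d s = (Memory.empty d, some t)) :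
      Yields n mx obs d 1 x s t x
  | advance {m x s s' t x'} (h : collect (mx x) (obs x) d s = (s', none))
      (h' : Yields n mx obs d m (succ n x) s' t x') : Yields n mx obs d (m + 1) x s t x'

variable {n : ℕ} {mx : (ℕ → ℕ) → ℕ → Bool} {obs : (ℕ → ℕ) → O} {d : ℕ}

/-- When digit `d` is maximal, the type just found is the last member of the set of rank `d + 1`,
which is therefore output. -/
theorem Yields.lift_last {m : ℕ} {x x' : ℕ → ℕ} {s : Memory O d} {t : Ty O d} (A : Set (Ty O d))
    (h : Yields n mx obs d m x s t x') (hx : mx x' d = true) :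
    Yields n mx obs (d + 1) m x (s, A) (insert t A : Set (Ty O d)) x' := by
  induction h with
  | output h => exact .output (by simp [collect, h, hx, Memory.empty])
  | advance h _ ih => exact .advance (by simp [collect, h]) (ih hx)

/-- Otherwise the type is stored and counting goes on with the next value of digit `d`. -/
theorem Yields.lift_not_last {m m' : ℕ} {x x' x'' : ℕ → ℕ} {s : Memory O d} {t : Ty O d}
    {A : Set (Ty O d)} {T : Ty O (d + 1)} (h : Yields n mx obs d m x s t x') (hx : mx x' d = false)
    (h' : Yields n mx obs (d + 1) m' (succ n x') (Memory.empty d, insert t A) T x'') :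
    Yields n mx obs (d + 1) (m' + m) x (s, A) T x'' := by
  induction h with
  | output h => exact .advance (by simp [collect, h, hx]) h'
  | advance h _ ih => exact .advance (by simp [collect, h]) (ih hx h')

/-- The tuple in which the digits below `d` have been set to the maximum. -/
def fill (n d : ℕ) (x : ℕ → ℕ) (j : ℕ) : ℕ :=
  if j < d then n - 1 else x j

theorem succ_fill {x : ℕ → ℕ} (hn : 0 < n) (h0 : ∀ j < d, x j = 0) (hx : x d + 1 ≠ n) :
    succ n (fill n d x) = Function.update x d (x d + 1) := by
  funext e
  rcases lt_trichotomy e d with he | rfl | he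
  · have h1 : ∀ j < e, fill n d x j + 1 = n := fun j hj => by
      rw [fill, if_pos (by omega)]; omega
    have h2 : fill n d x e + 1 = n := by rw [fill, if_pos he]; omega
    rw [succ, if_pos h1, if_pos h2, Function.update_of_ne he.ne, h0 e he]
  · have h1 : ∀ j < e, fill n e x j + 1 = n := fun j hj => by
      rw [fill, if_pos (by omega)]; omega
    have h2 : fill n e x e = x e := by rw [fill, if_neg (by omega)]
    rw [succ, if_pos h1, h2, if_neg hx, Function.update_self]
  · have h1 : ¬ ∀ j < e, fill n d x j + 1 = n := fun h => by
      have := h d he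
      rw [fill, if_neg (by omega)] at this
      exact hx this
    rw [succ, if_neg h1, fill, if_neg (by omega), Function.update_of_ne he.ne']

/-- Counting through all values of the digits below `d` yields the type of rank `d`. -/
theorem yields {N : ℕ} (hn : 0 < n) (hmx : ∀ x, ∀ j < N, mx x j = decide (x j + 1 = n)) (hd : d ≤ N)
    {x : ℕ → ℕ} (h0 : ∀ j < d, x j = 0) :
    Yields n mx obs d (n ^ d) x (Memory.empty d) (tp n obs d x) (fill n d x) := by
  induction d generalizing x with
  | zero =>
    have : fill n 0 x = x := by funext j; simp [fill]
    rw [this]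
    exact .output rfl
  | succ d ih =>
    -- Induction on the number `r` of values of digit `d` that come after the present value `v`; `A`
    -- holds the types found for earlier values.
    have key : ∀ r v : ℕ, ∀ x : ℕ → ℕ, ∀ A : Set (Ty O d), (∀ j < d, x j = 0) → x d = v →
        v + r + 1 = n → Yields n mx obs (d + 1) ((r + 1) * n ^ d) x (Memory.empty d, A)
          (A ∪ {t | ∃ w < n, v ≤ w ∧ tp n obs d (Function.update x d w) = t} : Set (Ty O d))
          (fill n (d + 1) x) := by
      intro r
      induction r with
      | zero =>
        intro v x A h0 hv hr
        have h1 := (ih (by omega) h0).lift_last A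
          (by rw [hmx _ _ (by omega), fill, if_neg (by omega)]; simp [hv]; omega)
        have e1 : fill n d x = fill n (d + 1) x := by
          funext j
          rcases lt_trichotomy j d with hj | rfl | hj
          · simp [fill, hj, Nat.lt_succ_of_lt hj]
          · simp [fill]; omega
          · simp [fill, Nat.not_lt.2 hj.le]
            intro; omega
        have e2 : (A ∪ {t | ∃ w < n, v ≤ w ∧ tp n obs d (Function.update x d w) = t} :
            Set (Ty O d)) = insert (tp n obs d x) A := by
          rw [Set.union_comm, Set.insert_eq]
          congr 1
          ext t
          constructor
          · rintro ⟨w, h1, h2, rfl⟩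
            obtain rfl : w = x d := by omega
            simp
          · rintro rfl
            exact ⟨x d, by omega, by omega, by simp⟩
        rw [e1] at h1
        rw [e2, Nat.zero_add, Nat.one_mul]
        exact h1
      | succ r ihr =>
        intro v x A h0 hv hr
        have hs : succ n (fill n d x) = Function.update x d (v + 1) := by
          rw [succ_fill hn h0 (by omega), hv]
        have h1 := (ih (by omega) h0).lift_not_last (A := A)
          (by rw [hmx _ _ (by omega), fill, if_neg (by omega)]; simp [hv]; omega)
          (by
            rw [hs]
            exact ihr (v + 1) (Function.update x d (v + 1)) (insert (tp n obs d x) A)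
              (fun j hj => by rw [Function.update_of_ne hj.ne, h0 j hj]) (by simp) (by omega))
        have e1 : fill n (d + 1) (Function.update x d (v + 1)) = fill n (d + 1) x := by
          funext j
          by_cases hj : j = d
          · simp [fill, hj]
          · simp [fill, hj]
        have e2 : (insert (tp n obs d x) A ∪ {t | ∃ w < n, v + 1 ≤ w ∧
            tp n obs d (Function.update (Function.update x d (v + 1)) d w) = t} : Set (Ty O d)) =
            A ∪ {t | ∃ w < n, v ≤ w ∧ tp n obs d (Function.update x d w) = t} := by
          ext t
          simp only [Function.update_idem, Set.mem_union, Set.mem_insert_iff, Set.mem_ofPred_eq]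
          constructor
          · rintro ((rfl | h) | ⟨w, h1, h2, h3⟩)
            · exact .inr ⟨v, by omega, le_rfl, by rw [← hv, Function.update_eq_self]⟩
            · exact .inl h
            · exact .inr ⟨w, h1, by omega, h3⟩
          · rintro (h | ⟨w, h1, h2, h3⟩)
            · exact .inl (.inr h)
            · rcases h2.eq_or_lt with rfl | h2
              · rw [← hv, Function.update_eq_self] at h3
                exact .inl (.inl h3.symm)
              · exact .inr ⟨w, h1, h2, h3⟩
        rw [e1, e2] at h1
        rw [Nat.add_mul (r + 1), Nat.one_mul]
        exact h1
    have h1 := key (n - 1) 0 x ∅ (fun j hj => h0 j (by omega)) (h0 d (by omega)) (by omega)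
    rw [Nat.sub_add_cancel hn, ← Nat.pow_succ'] at h1
    have e : (∅ ∪ {t | ∃ w < n, 0 ≤ w ∧ tp n obs d (Function.update x d w) = t} : Set (Ty O d)) =
        tp n obs (d + 1) x := by
      simp [tp]
    rw [e] at h1
    exact h1

end

end Odometer

end EdgeContraction

namespace EdgeContraction

/-! ### An odometer on the encoding of a graph -/

namespace Odometer

open Sweep

section Marks

variable {I : Type}

/-- A cell carries a bit of the input and the marks at this cell. -/
structure Cell (I : Type) where
  bit : Bool
  marks : I → Bool

/-- The movements of a mark. -/
inductive Move
  | keep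
  | shift
  | reset

/-- Whether the mark is at a cell after the movement, if `here` and `before` say whether it was
there or at the previous cell, and `first` whether there is no previous cell. -/
def Move.apply (here before first : Bool) : Move → Bool
  | .keep => here
  | .shift => before
  | .reset => first

/-- What is remembered while sweeping over the tape: whether the separator has been passed, whether
the present cell is the first of its part, the old marks of the previous cell, the new marks of the
last cell before the separator, which marks have met, and the bit at the pointer `none`. -/
structure Scan (I : Type) where
  sep : Bool
  first : Bool
  prev : I → Bool
  last : I → Bool
  meets : I → I → Bool
  bit : Bool

instance [Finite I] : Finite (Cell I) :=
  .of_injective (fun c => (c.bit, c.marks)) fun ⟨_, _⟩ ⟨_, _⟩ h => by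
    simp only [Prod.mk.injEq] at h
    obtain ⟨rfl, rfl⟩ := h
    rfl

instance : Finite Move :=
  .of_injective (fun m => ((match m with | .keep => 0 | .shift => 1 | .reset => 2) : Fin 3))
    fun m m' h => by cases m <;> cases m' <;> first | rfl | simp at h

instance [Finite I] : Finite (Scan I) :=
  .of_injective (fun c => (c.sep, c.first, c.prev, c.last, c.meets, c.bit))
    fun ⟨_, _, _, _, _, _⟩ ⟨_, _, _, _, _, _⟩ h => by
      simp only [Prod.mk.injEq] at h
      obtain ⟨rfl, rfl, rfl, rfl, rfl, rfl⟩ := h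
      rfl

/-- The state before a sweep. -/
def Scan.start : Scan I :=
  ⟨false, true, fun _ => false, fun _ => false, fun _ _ => false, false⟩

/-- The new marks of a cell. -/
def newMarks (act : I → Move) (q : Scan I) (c : Cell I) (i : I) : Bool :=
  (act i).apply (c.marks i) (q.prev i) q.first

/-- The transducer that moves the marks. -/
def move (act : Option I → Move) (q : Scan (Option I)) (c : Cell (Option I)) :
    Scan (Option I) × Cell (Option I) :=
  if q.sep then
    ({ q with
        first := false
        prev := c.marks
        bit := q.bit || (newMarks act q c none && c.bit) }, ⟨c.bit, newMarks act q c⟩)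
  else if c.bit then
    ({ q with
        first := false
        prev := c.marks
        last := newMarks act q c
        meets := fun i j => q.meets i j || (newMarks act q c i && newMarks act q c j) },
      ⟨c.bit, newMarks act q c⟩)
  else ({ q with
        sep := true
        first := true
        prev := fun _ => false }, c)

/-- The tape with the given marks at the cells of both parts. -/
def tape (n : ℕ) (a : ℕ → Bool) (μ : ℕ → I → Bool) : List (Cell I) :=
  (List.range n).map (fun v => ⟨true, μ v⟩) ++ ⟨false, fun _ => false⟩ ::
    (List.range (n * n)).map fun p => ⟨a p, μ p⟩

/-- The marks of the previous cell. -/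
def before (μ : ℕ → I → Bool) : ℕ → I → Bool
  | 0, _ => false
  | v + 1, i => μ v i

theorem scan_map_range {C Q : Type} (δ : Q → C → Q × C) (q : ℕ → Q) (g g' : ℕ → C) (n : ℕ)
    (h : ∀ v < n, δ (q v) (g v) = (q (v + 1), g' v)) :
    scan δ (q 0) ((List.range n).map g) = (q n, (List.range n).map g') := by
  induction n with
  | zero => rfl
  | succ n ih =>
    rw [List.range_succ, List.map_append, scan_append, ih fun v hv => h v (by omega)]
    simp [scan, h n (by omega)]

/-- The state after the sweep that moves mark `i` to position `y i`. -/
def Scan.final (n : ℕ) (a : ℕ → Bool) (y : Option I → ℕ) : Scan (Option I) where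
  sep := true
  first := decide (n * n = 0)
  prev := fun _ => false
  last i := decide (y i + 1 = n)
  meets i j := decide (y i = y j ∧ y i < n)
  bit := decide (y none < n * n) && a (y none)

/-- The state after each cell is given explicitly. Up to the separator `last` holds the new marks of
the preceding cell, so from there on it tells which marks are at position `n - 1`. -/
theorem scan_tape (act : Option I → Move) (n : ℕ) (a : ℕ → Bool) (μ : ℕ → Option I → Bool)
    (y : Option I → ℕ) (h : ∀ v i, (act i).apply (μ v i) (before μ v i) (decide (v = 0)) =
      decide (y i = v)) :
    scan (move act) .start (tape n a μ) =
      ({ Scan.final n a y with prev := before μ (n * n) }, tape n a fun v i => decide (y i = v)) := by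
  have h1 := scan_map_range (move act) (fun v => (⟨false, decide (v = 0), before μ v,
      fun i => decide (y i + 1 = v), fun i j => decide (y i = y j ∧ y i < v), false⟩ :
        Scan (Option I)))
    (fun v => ⟨true, μ v⟩) (fun v => ⟨true, fun i => decide (y i = v)⟩) n fun v _ => by
      have e : newMarks act (⟨false, decide (v = 0), before μ v,
          fun i => decide (y i + 1 = v), fun i j => decide (y i = y j ∧ y i < v), false⟩ :
            Scan (Option I)) ⟨true, μ v⟩ = fun i => decide (y i = v) := funext fun i => h v i
      simp only [move, e]
      simp only [Bool.false_eq_true, if_false, if_true, Prod.mk.injEq, and_true, Scan.mk.injEq,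
        true_and]
      refine ⟨by simp, rfl, by simp, ?_⟩
      funext i j
      rw [← Bool.decide_and, ← Bool.decide_or, decide_eq_decide]
      omega
  have h2 := scan_map_range (move act) (fun p => (⟨true, decide (p = 0), before μ p,
      fun i => decide (y i + 1 = n), fun i j => decide (y i = y j ∧ y i < n),
      decide (y none < p) && a (y none)⟩ : Scan (Option I)))
    (fun p => ⟨a p, μ p⟩) (fun p => ⟨a p, fun i => decide (y i = p)⟩) (n * n) fun p _ => by
      have e : newMarks act (⟨true, decide (p = 0), before μ p,
          fun i => decide (y i + 1 = n), fun i j => decide (y i = y j ∧ y i < n),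
          decide (y none < p) && a (y none)⟩ : Scan (Option I)) ⟨a p, μ p⟩ =
          fun i => decide (y i = p) := funext fun i => h p i
      simp only [move, e]
      simp only [if_true, Prod.mk.injEq, and_true, Scan.mk.injEq, true_and]
      refine ⟨by simp, rfl, ?_⟩
      rcases lt_trichotomy (y none) p with hp | hp | hp
      · simp [hp, hp.ne, hp.le]
      · simp [hp]
      · simp [hp.ne', Nat.not_lt.2 hp.le, Nat.not_le.2 hp]
  have e1 : (Scan.start : Scan (Option I)) = ⟨false, decide (0 = 0), before μ 0,
      fun i => decide (y i + 1 = 0), fun i j => decide (y i = y j ∧ y i < 0), false⟩ := by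
    simp [Scan.start]
    rfl
  have e2 : move act ⟨false, decide (n = 0), before μ n, fun i => decide (y i + 1 = n),
      fun i j => decide (y i = y j ∧ y i < n), false⟩ ⟨false, fun _ => false⟩ =
      (⟨true, decide (0 = 0), before μ 0, fun i => decide (y i + 1 = n),
        fun i j => decide (y i = y j ∧ y i < n), decide (y none < 0) && a (y none)⟩,
        ⟨false, fun _ => false⟩) := by
    simp [move]
    rfl
  rw [tape, scan_append, e1, h1]
  rw [scan, e2]
  exact congrArg (fun r => (r.1, (List.range n).map (fun v => (⟨true, fun i => decide (y i = v)⟩ :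
    Cell (Option I))) ++ ⟨false, fun _ => false⟩ :: r.2)) h2

end Marks

section Machine

/-- The observations at a tuple of `N` digits: which digits are equal, and the bit at the entry
given by the digits `1` and `0`. -/
abbrev Obs (N : ℕ) : Type :=
  (Fin N → Fin N → Bool) × Bool

/-- The observations at the tuple `x`. -/
def observe (N n : ℕ) (a : ℕ → Bool) (x : ℕ → ℕ) : Obs N :=
  (fun i j => decide (x i = x j), a (x 1 * n + x 0))

/-- The positions of the marks for the tuple `x`; the pointer is at the entry given by the digits
`1` and `0`. -/
def position (N n : ℕ) (x : ℕ → ℕ) : Option (Fin N) → ℕ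
  | none => x 1 * n + x 0
  | some i => x i

/-- The movements of the marks, if `mx` says which digits are maximal. -/
def movement (N : ℕ) (mx : ℕ → Bool) : Option (Fin N) → Move
  | none => if mx 0 && mx 1 then .reset else .shift
  | some i => if ∀ j < i.1, mx j then if mx i then .reset else .shift else .keep

/-- Which digits are maximal, seen from the marks of the last cell. -/
def maximal (N : ℕ) (last : Option (Fin N) → Bool) (j : ℕ) : Bool :=
  if h : j < N then last (some ⟨j, h⟩) else false

/-- The entry `x 1 * n + x 0` advances by exactly one at each tick, also at a carry from digit `0`
to digit `1`, until both wrap around. So one shift or reset suffices for the pointer, which is why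
only the entry at the two lowest digits is observed. -/
theorem movement_apply {N n : ℕ} (hN : 2 ≤ N) {x : ℕ → ℕ} {mx : ℕ → Bool}
    (hmx : ∀ j < N, mx j = decide (x j + 1 = n)) (v : ℕ) (i : Option (Fin N)) :
    (movement N mx i).apply (decide (position N n x i = v))
      (before (fun v i => decide (position N n x i = v)) v i) (decide (v = 0)) =
      decide (position N n (succ n x) i = v) := by
  have hb : before (fun v i => decide (position N n x i = v)) v i =
      decide (position N n x i + 1 = v) := by
    cases v <;> simp [before]
  rw [hb]
  cases i with
  | none =>
    have h0 : succ n x 0 = if x 0 + 1 = n then 0 else x 0 + 1 := by simp [succ]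
    have h1 : succ n x 1 = if x 0 + 1 = n then if x 1 + 1 = n then 0 else x 1 + 1 else x 1 := by
      simp [succ]
    have p0 : position N n x none = x 1 * n + x 0 := rfl
    have p1 : position N n (succ n x) none = succ n x 1 * n + succ n x 0 := rfl
    rw [p0, p1, h0, h1, movement, hmx 0 (by omega), hmx 1 (by omega)]
    by_cases e0 : x 0 + 1 = n
    · by_cases e1 : x 1 + 1 = n
      · simp [e0, e1, Move.apply, eq_comm]
      · simp only [e0, e1, decide_true, decide_false, Bool.and_false, Bool.false_eq_true, if_false,
          if_true, Move.apply, decide_eq_decide]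
        rw [Nat.add_mul, Nat.one_mul]
        omega
    · simp only [e0, decide_false, Bool.false_and, Bool.false_eq_true, if_false, Move.apply,
        decide_eq_decide]
      omega
  | some i =>
    have h : (∀ j < i.1, mx j = true) ↔ ∀ j < i.1, x j + 1 = n :=
      forall₂_congr fun j hj => by rw [hmx j (by omega), decide_eq_true_iff]
    simp only [movement, position, succ, h, hmx i i.2, decide_eq_true_iff]
    split_ifs <;> simp [Move.apply, eq_comm]

variable {N : ℕ}

/-- What is constant during a sweep: the movements and the collected types. -/
abbrev Control (N : ℕ) : Type :=
  (Option (Fin N) → Move) × Memory (Obs N) N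

/-- The transducer of the odometer. -/
def sweep (q : Control N × Scan (Option (Fin N))) (c : Cell (Option (Fin N))) :
    (Control N × Scan (Option (Fin N))) × Cell (Option (Fin N)) :=
  ((q.1, (move q.1.1 q.2 c).1), (move q.1.1 q.2 c).2)

theorem scan_sweep (r : Control N) (q : Scan (Option (Fin N))) (l : List (Cell (Option (Fin N)))) :
    scan sweep (r, q) l = ((r, (scan (move r.1) q l).1), (scan (move r.1) q l).2) := by
  induction l generalizing q with
  | nil => rfl
  | cons c l ih => simp [scan, sweep, ih]

/-- The end of a sweep of the odometer; the answer depends on the final type only. -/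
def finish (F : Ty (Obs N) N → Bool) (q : Control N × Scan (Option (Fin N))) :
    (Control N × Scan (Option (Fin N))) ⊕ Bool :=
  match collect (maximal N q.2.last) (fun i j => q.2.meets (some i) (some j), q.2.bit) N q.1.2 with
  | (_, some t) => .inr (F t)
  | (s, none) => .inl ((movement N (maximal N q.2.last), s), .start)

/-- One sweep per observation: it carries out the movements decided at the end of the previous sweep
and observes the resulting tuple. -/
theorem haltsIn_of_yields (hN : 2 ≤ N) {n : ℕ} {a : ℕ → Bool} (F : Ty (Obs N) N → Bool) {m : ℕ}
    {x x' : ℕ → ℕ} {s : Memory (Obs N) N} {t : Ty (Obs N) N} {act : Option (Fin N) → Move}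
    {μ : ℕ → Option (Fin N) → Bool} (hx : ∀ j, x j < n)
    (h : Yields n (fun x => maximal N fun i => decide (position N n x i + 1 = n))
      (observe N n a) N m x s t x')
    (hμ : ∀ v i, (act i).apply (μ v i) (before μ v i) (decide (v = 0)) =
      decide (position N n x i = v)) :
    HaltsIn sweep (finish F) m ((act, s), .start) (tape n a μ) (F t) := by
  have obs (x : ℕ → ℕ) (hx : ∀ j, x j < n) :
      (((fun i j => (Scan.final n a (position N n x)).meets (some i) (some j),
        (Scan.final n a (position N n x)).bit)) : Obs N) = observe N n a x := by
    have : x 1 * n + x 0 < n * n := by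
      calc x 1 * n + x 0 < x 1 * n + n := by have := hx 0; omega
        _ = (x 1 + 1) * n := by ring
        _ ≤ n * n := Nat.mul_le_mul_right _ (hx 1)
    simp [Scan.final, observe, position, hx, this]
  induction h generalizing act μ with
  | output h =>
    refine .inl ?_
    rw [scan_sweep, scan_tape _ _ _ _ _ hμ]
    simp only [finish, obs _ hx]
    erw [h]
  | @advance m x s s' t x' h _ ih =>
    refine .inr ⟨((movement N (maximal N fun i => decide (position N n x i + 1 = n)), s'), .start),
      ?_, ?_⟩
    · rw [scan_sweep, scan_tape _ _ _ _ _ hμ]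
      simp only [finish, obs _ hx]
      erw [h]
      rfl
    · rw [scan_sweep, scan_tape _ _ _ _ _ hμ]
      exact ih (succ_lt hx) (movement_apply hN fun j hj => by simp [maximal, hj]; rfl)

/-- A property of binary strings of the form `1ⁿ0w` with `w` of length `n²` can be decided in
polynomial time, if it depends only on the type of some rank. -/
theorem polyTime (hN : 2 ≤ N) (F : Ty (Obs N) N → Bool) {α : Type} (ea : α → List Bool)
    (n : α → ℕ) (a : α → ℕ → Bool) (hn : ∀ w, 0 < n w)
    (hea : ∀ w, ea w = List.replicate (n w) true ++ false :: (List.range (n w * n w)).map (a w))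
    (f : α → Bool) (hf : ∀ w, f w = F (tp (n w) (observe N (n w) (a w)) N fun _ => 0)) :
    Nonempty (Turing.TM2ComputableInPolyTime ea Computability.encodeBool f) := by
  have := Fintype.ofFinite (Cell (Option (Fin N)))
  have := Fintype.ofFinite (Control N × Scan (Option (Fin N)))
  refine Sweep.polyTime (fun b => ⟨b, fun _ => false⟩) sweep (finish F)
    -- The input carries no marks; resetting all of them in the first sweep produces the tuple `0`.
    -- There are `n ^ N` tuples, and `n` is at most the input length.
    ((fun _ => .reset, Memory.empty N), .start) ea f (Polynomial.X ^ N) fun w => ?_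
  have e : (ea w).map (fun b => (⟨b, fun _ => false⟩ : Cell (Option (Fin N)))) =
      tape (n w) (a w) fun _ _ => false := by
    rw [hea, tape, List.map_append, List.map_cons, List.map_map]
    congr 1
    simp
  have h1 := yields (N := N) (obs := observe N (n w) (a w)) (hn w)
    (mx := fun x => maximal N fun i => decide (position N (n w) x i + 1 = n w))
    (fun x j hj => by simp [maximal, hj]; rfl) le_rfl (x := fun _ => 0) fun _ _ => rfl
  rw [e, hf]
  refine HaltsIn.mono ?_ (haltsIn_of_yields hN F (fun _ => hn w) h1 fun v i => ?_)
  · rw [Polynomial.eval_pow, Polynomial.eval_X, hea]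
    exact Nat.pow_le_pow_left (by simp) _
  · cases i <;> simp [Move.apply, position, eq_comm]

end Machine

end Odometer

end EdgeContraction

namespace EdgeContraction

/-! ### First-order properties can be decided in polynomial time -/

namespace Odometer

open FirstOrder

section

open Classical in
/-- The entries of the adjacency matrix, row by row. -/
noncomputable def entry {n : ℕ} (G : SimpleGraph (Fin n)) (p : ℕ) : Bool :=
  decide (∃ i j : Fin n, p = i * n + j ∧ G.Adj i j)

open Classical in
theorem entry_eq_true_iff {n : ℕ} (G : SimpleGraph (Fin n)) (i j : Fin n) :
    entry G (i * n + j) = true ↔ G.Adj i j := by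
  rw [entry, decide_eq_true_iff]
  refine ⟨?_, fun h => ⟨i, j, rfl, h⟩⟩
  rintro ⟨i', j', h, hadj⟩
  have hj : j = j' := Fin.ext <| by
    have := congrArg (· % n) h
    simpa [Nat.mul_add_mod', Nat.mod_eq_of_lt] using this
  subst hj
  have hi : i = i' := Fin.ext <| Nat.eq_of_mul_eq_mul_right (by have := i.2; omega)
    (Nat.add_right_cancel h)
  rwa [hi]

theorem range_mul (m n : ℕ) : List.range (m * n) =
    (List.range m).flatMap fun i => (List.range n).map fun j => i * n + j := by
  induction m with
  | zero => simp
  | succ m ih => rw [Nat.add_mul, Nat.one_mul, List.range_add, ih, List.range_succ]; simp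

open Classical in
theorem encodeGraph_eq (G : FinGraph) : encodeGraph G =
    List.replicate G.1 true ++ false :: (List.range (G.1 * G.1)).map (entry G.2) := by
  obtain ⟨n, G⟩ := G
  have e : List.range n = (List.finRange n).map Fin.val := by simp
  rw [encodeGraph, range_mul, List.map_flatMap]
  congr 2
  simp only [e, List.flatMap_map, List.map_map]
  refine congrArg (fun f => List.flatMap f _) (funext fun i => List.map_congr_left fun j _ => ?_)
  rw [Bool.eq_iff_iff, decide_eq_true_iff]
  exact (entry_eq_true_iff G i j).symm

variable {O : Type} {N n n' : ℕ} {a a' : ℕ → Bool} {x x' : ℕ → ℕ}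

theorem exists_tp_update {obs obs' : (ℕ → ℕ) → O} {d : ℕ}
    (h : tp n obs (d + 1) x = tp n' obs' (d + 1) x') {v : ℕ} (hv : v < n) :
    ∃ v' < n', tp n obs d (Function.update x d v) = tp n' obs' d (Function.update x' d v') := by
  obtain ⟨v', hv', h1⟩ := (Set.ext_iff.1 h (tp n obs d (Function.update x d v))).1 ⟨v, hv, rfl⟩
  exact ⟨v', hv', h1.symm⟩

/-- Assign the digits below `d` by back-and-forth (`exists_tp_update`) down to rank `0`, where
equalities are observed; the digits from `d` on do not change. -/
theorem eq_iff_of_tp (hn : 0 < n) {d : ℕ}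
    (h : tp n (observe N n a) d x = tp n' (observe N n' a') d x') {e e' : ℕ} (he : d ≤ e)
    (he' : d ≤ e') (hN : e < N) (hN' : e' < N) : x e = x e' ↔ x' e = x' e' := by
  induction d generalizing x x' with
  | zero =>
    have := congrFun (congrFun (congrArg Prod.fst h) ⟨e, hN⟩) ⟨e', hN'⟩
    simpa [tp, observe] using this
  | succ d ih =>
    obtain ⟨v', -, h⟩ := exists_tp_update h hn
    have := ih h (by omega) (by omega)
    rwa [Function.update_of_ne (by omega), Function.update_of_ne (by omega),
      Function.update_of_ne (by omega), Function.update_of_ne (by omega)] at this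

/-- Let digits `1` and `0` copy digits `e` and `e'`. Equal types force the same copies in the other
tuple, and the observed bit is the wanted entry. This costs two digits. -/
theorem bit_eq_of_tp (hn : 0 < n) {d : ℕ}
    (h : tp n (observe N n a) (d + 2) x = tp n' (observe N n' a') (d + 2) x') {e e' : ℕ}
    (he : d + 2 ≤ e) (he' : d + 2 ≤ e') (hN : e < N) (hN' : e' < N) (hx : x e < n)
    (hx' : x e' < n) : a (x e * n + x e') = a' (x' e * n' + x' e') := by
  induction d generalizing x x' with
  | zero =>
    obtain ⟨v, -, h⟩ := exists_tp_update h hx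
    have h1 := eq_iff_of_tp hn h (e := 1) (e' := e) le_rfl (by omega) (by omega) hN
    rw [Function.update_self, Function.update_self, Function.update_of_ne (by omega),
      Function.update_of_ne (by omega)] at h1
    obtain rfl := h1.1 rfl
    obtain ⟨w, -, h⟩ := exists_tp_update h hx'
    have h2 := eq_iff_of_tp hn h (e := 0) (e' := e') le_rfl (by omega) (by omega) hN'
    rw [Function.update_self, Function.update_self, Function.update_of_ne (by omega),
      Function.update_of_ne (by omega), Function.update_of_ne (by omega),
      Function.update_of_ne (by omega)] at h2
    obtain rfl := h2.1 rfl
    simpa [tp, observe] using congrArg Prod.snd h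
  | succ d ih =>
    obtain ⟨v', -, h⟩ := exists_tp_update h hn
    have := ih h (by omega) (by omega)
    rw [Function.update_of_ne (by omega), Function.update_of_ne (by omega),
      Function.update_of_ne (by omega), Function.update_of_ne (by omega)] at this
    exact this hx hx'

theorem exists_term_eq {i : ℕ} (t : Language.graph.Term (Empty ⊕ Fin i)) :
    ∃ j, t = .var (Sum.inr j) := by
  cases t with
  | var s =>
    rcases s with s | j
    · exact s.elim
    · exact ⟨j, rfl⟩
  | func f _ => exact Empty.elim f

/-- Tuples of the same type of sufficiently large rank satisfy the same formula. The variable `j`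
corresponds to the digit `N - 1 - j`. -/
theorem realize_iff_of_tp {i : ℕ} (φ : Language.graph.BoundedFormula Empty i) :
    ∃ d₀, ∀ N d, N = i + d → d₀ ≤ d → ∀ {n n'} (G : SimpleGraph (Fin n)) (G' : SimpleGraph (Fin n'))
      (x x' : ℕ → ℕ) (v : Fin i → Fin n) (v' : Fin i → Fin n'), 0 < n → 0 < n' →
      tp n (observe N n (entry G)) d x = tp n' (observe N n' (entry G')) d x' →
      (∀ j, (v j : ℕ) = x (N - 1 - j)) → (∀ j, (v' j : ℕ) = x' (N - 1 - j)) →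
      (@Language.BoundedFormula.Realize _ _ G.structure _ _ φ default v ↔
        @Language.BoundedFormula.Realize _ _ G'.structure _ _ φ default v') := by
  induction φ with
  | falsum => exact ⟨0, fun _ _ _ _ _ _ _ _ _ _ _ _ _ _ _ _ _ => Iff.rfl⟩
  | @equal i t t' =>
    obtain ⟨j, rfl⟩ := exists_term_eq t
    obtain ⟨j', rfl⟩ := exists_term_eq t'
    refine ⟨0, fun N d hN _ n n' G G' x x' v v' hn _ h hv hv' => ?_⟩
    have := eq_iff_of_tp hn h (e := N - 1 - j) (e' := N - 1 - j') (by omega) (by omega) (by omega)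
      (by omega)
    rw [← hv, ← hv, ← hv', ← hv', Fin.val_inj, Fin.val_inj] at this
    exact this
  | @rel i l R ts =>
    cases R
    obtain ⟨j, hj⟩ := exists_term_eq (ts 0)
    obtain ⟨j', hj'⟩ := exists_term_eq (ts 1)
    refine ⟨2, fun N d hN hd n n' G G' x x' v v' hn _ h hv hv' => ?_⟩
    obtain ⟨d, rfl⟩ : ∃ k, d = k + 2 := ⟨d - 2, by omega⟩
    have := bit_eq_of_tp hn h (e := N - 1 - j) (e' := N - 1 - j') (by omega) (by omega) (by omega)
      (by omega) (hv j ▸ (v j).2) (hv j' ▸ (v j').2)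
    rw [← hv, ← hv, ← hv', ← hv', Bool.eq_iff_iff, entry_eq_true_iff, entry_eq_true_iff] at this
    have key {n} (G : SimpleGraph (Fin n)) (v : Fin i → Fin n) :
        @Language.BoundedFormula.Realize _ _ G.structure _ _ (.rel .adj ts) default v ↔
          G.Adj (v j) (v j') := by
      let := G.structure
      change G.Adj ((ts 0).realize _) ((ts 1).realize _) ↔ _
      rw [hj, hj']
      rfl
    exact (key G v).trans (this.trans (key G' v').symm)
  | imp _ _ ih ih' =>
    obtain ⟨d₀, h₀⟩ := ih
    obtain ⟨d₁, h₁⟩ := ih'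
    refine ⟨max d₀ d₁, fun N d hN hd n n' G G' x x' v v' hn hn' h hv hv' => ?_⟩
    exact imp_congr (h₀ N d hN (by omega) G G' x x' v v' hn hn' h hv hv')
      (h₁ N d hN (by omega) G G' x x' v v' hn hn' h hv hv')
  | @all i φ ih =>
    obtain ⟨d₀, h₀⟩ := ih
    refine ⟨d₀ + 1, fun N d hN hd n n' G G' x x' v v' hn hn' h hv hv' => ?_⟩
    obtain ⟨d, rfl⟩ : ∃ k, d = k + 1 := ⟨d - 1, by omega⟩
    have snoc {n} {x : ℕ → ℕ} {v : Fin i → Fin n} (hv : ∀ j, (v j : ℕ) = x (N - 1 - j))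
        (w : Fin n) (j : Fin (i + 1)) : ((Fin.snoc v w : Fin (i + 1) → Fin n) j : ℕ) =
          Function.update x d w (N - 1 - j) := by
      refine Fin.lastCases ?_ (fun j => ?_) j
      · rw [Fin.snoc_last, Fin.val_last, show N - 1 - i = d by omega, Function.update_self]
      · rw [Fin.snoc_castSucc, Fin.val_castSucc, hv, Function.update_of_ne (by omega)]
    constructor
    · intro hall w'
      -- Ehrenfeucht–Fraïssé step: a value of the new variable on one side is answered on the other,
      -- preserving the type of rank one less.
      obtain ⟨w, hw, h1⟩ := exists_tp_update h.symm w'.2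
      exact (h₀ N d (by omega) (by omega) G G' _ _ _ _ hn hn' h1.symm (snoc hv ⟨w, hw⟩)
        (snoc hv' w')).1 (hall ⟨w, hw⟩)
    · intro hall w
      obtain ⟨w', hw', h1⟩ := exists_tp_update h w.2
      exact (h₀ N d (by omega) (by omega) G G' _ _ _ _ hn hn' h1 (snoc hv w)
        (snoc hv' ⟨w', hw'⟩)).2 (hall ⟨w', hw'⟩)

open Classical in
/-- First-order properties of nonempty graphs can be decided in polynomial time. -/
theorem polyTimeDecidableOn (φ : Language.graph.Sentence) {𝒞 Y : Set FinGraph}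
    (h𝒞 : ∀ G ∈ 𝒞, 0 < G.1)
    (hY : ∀ G ∈ 𝒞, @Language.Sentence.Realize _ _ G.2.structure φ ↔ G ∈ Y) :
    PolyTimeDecidableOn 𝒞 Y := by
  obtain ⟨d₀, h⟩ := realize_iff_of_tp φ
  refine polyTime (N := d₀ + 2) (by omega)
    -- There are finitely many types, so this is a fixed table built into the machine and never
    -- computed. It answers correctly because nonempty graphs of the same type agree on `φ`.
    (fun t => decide (∃ G : FinGraph, 0 < G.1 ∧ @Language.Sentence.Realize _ _ G.2.structure φ ∧
      tp G.1 (observe (d₀ + 2) G.1 (entry G.2)) (d₀ + 2) (fun _ => 0) = t))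
    (fun G : 𝒞 => encodeGraph G.1) (fun G => G.1.1) (fun G => entry G.1.2) (fun G => h𝒞 _ G.2)
    (fun G => encodeGraph_eq _) _ fun G => ?_
  rw [Bool.eq_iff_iff, decide_eq_true_iff, decide_eq_true_iff, ← hY _ G.2]
  refine ⟨fun hG => ⟨G.1, h𝒞 _ G.2, hG, rfl⟩, ?_⟩
  rintro ⟨G', hn, hG', ht⟩
  exact (h (d₀ + 2) (d₀ + 2) (by omega) (by omega) G'.2 G.1.2 _ _ _ _ hn (h𝒞 _ G.2) ht
    (fun j => j.elim0) (fun j => j.elim0)).1 hG'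

end

end Odometer

end EdgeContraction

theorem theorem2 (k : ℕ) :
    EdgeContraction.PolyTimeDecidableOn
      {G | G.2.Connected ∧ EdgeContraction.InducedFree (EdgeContraction.P3kP2 k) G.2}
      {G | EdgeContraction.IsYesInstance G.2} := by
  obtain ⟨φ, hφ⟩ := EdgeContraction.IsFirstOrder.isYesInstance k
  exact EdgeContraction.Odometer.polyTimeDecidableOn φ
    (fun G hG => Fin.pos_iff_nonempty.2 hG.1.nonempty) fun G hG => hφ _ G.2 hG.1 hG.2
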